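/- Let $1\le p<\infty$, let $M'$ be a compact Riemannian manifold with metric $g$ (smooth, without boundary) and let $(G_i)_{i\in I}$ be a finite covering of $M'$ by open sets. Let $N$ be a compact Riemannian manifold (smooth, without boundary), isometrically embedded into some $\mathbb{R}^\nu$. For $G\subseteq M'$ open, the collar $G\times[0,1)$ carries the product metric $g+\mathrm{d}t^2$, and $$\dot W^{1,p}(G\times[0,1),N)=\Big\{U\colon G\times(0,1)\to N \;:\; U\text{ is weakly differentiable as an }\mathbb{R}^\nu\text{-valued map in local charts and }\int_{G\times(0,1)}|\mathrm{D}U|^p<\infty\Big\},$$ where the norm $|\mathrm{D}U|$ (Hilbert–Schmidt norm) and the measure are induced by the Riemannian metrics. A map $u\colon G\to N$ is the trace of $U$ on $G\simeq G\times\{0\}$, written $u=\operatorname{tr}_G U$, if for every compact $K\subseteq G$ one has $\frac1\varepsilon\int_0^\varepsilon\int_K|U(x,t)-u(x)|\,\mathrm{d}x\,\mathrm{d}t\to0$ as $\varepsilon\to0^+$; thus $u$ is determined almost everywhere. The extension energy of $u$ is $$\mathfrak{E}^{1,p}_{\mathrm{ext}}(u,G,G\times[0,1))=\inf\Big\{\int_{G\times(0,1)}|\mathrm{D}U|^p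 \;:\; U\in\dot W^{1,p}(G\times[0,1),N),\ \operatorname{tr}_G U=u\Big\}\in[0,\infty],\qquad \inf\emptyset=\infty.$$ Then, for every Borel-measurable $u\colon M'\to N$, $$u\in\operatorname{tr}_{M'}\dot W^{1,p}(M'\times[0,1),N)\iff u|_{G_i}\in\operatorname{tr}_{G_i}\dot W^{1,p}(G_i\times[0,1),N)\ \text{ for every } i\in I .$$ Moreover, $$\mathfrak{E}^{1,p}_{\mathrm{ext}}(u,M',M'\times[0,1))\le C\sum_{i\in I}\mathfrak{E}^{1,p}_{\mathrm{ext}}(u|_{G_i},G_i,G_i\times[0,1)),$$ where the constant $C<\infty$ depends only on $p$ and on the covering $(G_i)_{i\in I}$ of the Riemannian manifold $M'$ (not on $N$, $\nu$, the embedding, or $u$). -/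

import Mathlib

open MeasureTheory Set Filter Topology Bundle
open scoped Manifold ContDiff ENNReal NNReal

noncomputable section

namespace Collar

/-! ### Riemannian volume -/

section Riemannian

variable {d : ℕ} {M : Type*} [TopologicalSpace M] [ChartedSpace (EuclideanSpace ℝ (Fin d)) M]
  [RiemannianBundle (fun x : M => TangentSpace (𝓡 d) x)]

/-- The `j`-th coordinate vector field `∂ⱼ` of the chart `e`, at the point with coordinates `y`. -/
def coordVec (e : OpenPartialHomeomorph M (EuclideanSpace ℝ (Fin d)))
    (y : EuclideanSpace ℝ (Fin d)) (j : Fin d) : TangentSpace (𝓡 d) (e.symm y) :=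
  mfderiv (𝓡 d) (𝓡 d) e.symm y (EuclideanSpace.single j (1 : ℝ))

/-- The Riemannian volume density `√(det (g(∂ᵢ, ∂ⱼ)))` in the chart `e`. -/
def volumeDensity (e : OpenPartialHomeomorph M (EuclideanSpace ℝ (Fin d)))
    (y : EuclideanSpace ℝ (Fin d)) : ℝ :=
  √(Matrix.gram ℝ (coordVec e y)).det

variable (d M) in
/-- The Riemannian volume measure of a (second countable) Riemannian manifold.
For a chart `e`, the measure under the supremum is the one that lives on `e.source` and is
`√(det g) dy` in the coordinates of `e`. These measures agree on the overlaps of charts, and their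
least upper bound is the measure that restricts to each of them on the domain of its chart. -/
def riemannianVolume [MeasurableSpace M] : Measure M :=
  ⨆ e ∈ IsManifold.maximalAtlas (𝓡 d) ∞ M,
    Measure.map e.symm ((volume.restrict e.target).withDensity
      fun y => ENNReal.ofReal (volumeDensity e y))

/-- The finite-dimensionality of tangent spaces. -/
instance finiteDimensional_tangentSpace (x : M) :
    FiniteDimensional ℝ (TangentSpace (𝓡 d) x) :=
  inferInstanceAs (FiniteDimensional ℝ (EuclideanSpace ℝ (Fin d)))

/-! ### Maps on the collar `M × [0,1)`

The domain is `G × [0,1)`, for `G ⊆ M` open, with the product Riemannian metric `g + dt²`.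
Maps are functions on all of `M × ℝ`, of which only the values on `G × (0,1)` matter.
The target is `F = ℝ^ν`. -/

variable {F : Type*} [NormedAddCommGroup F] [InnerProductSpace ℝ F]

/-- `DU` is the weak derivative of `U : G × (0,1) → F`: in each chart `e` of `M` (times the
identity of `(0,1)`), for each direction `v`, the function `U` and the derivative `DU` of `U` in the
direction `v` are locally integrable and the integration by parts formula holds for all test
functions. -/
structure HasWeakDeriv (G : Set M) (U : M × ℝ → F)
    (DU : (q : M × ℝ) → TangentSpace (𝓡 d) q.1 × ℝ →ₗ[ℝ] F) : Prop where
  locallyIntegrableOn : ∀ e ∈ IsManifold.maximalAtlas (𝓡 d) ∞ M,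
    LocallyIntegrableOn
      (fun z : EuclideanSpace ℝ (Fin d) × ℝ => U (e.symm z.1, z.2))
      ((e.target ∩ e.symm ⁻¹' G) ×ˢ Ioo 0 1)
  locallyIntegrableOn_deriv : ∀ e ∈ IsManifold.maximalAtlas (𝓡 d) ∞ M,
    ∀ v : EuclideanSpace ℝ (Fin d) × ℝ, LocallyIntegrableOn
      (fun z : EuclideanSpace ℝ (Fin d) × ℝ =>
        DU (e.symm z.1, z.2) (mfderiv (𝓡 d) (𝓡 d) e.symm z.1 v.1, v.2))
      ((e.target ∩ e.symm ⁻¹' G) ×ˢ Ioo 0 1)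
  integral_eq : ∀ e ∈ IsManifold.maximalAtlas (𝓡 d) ∞ M,
    ∀ v : EuclideanSpace ℝ (Fin d) × ℝ, ∀ ψ : EuclideanSpace ℝ (Fin d) × ℝ → ℝ,
    ContDiff ℝ ∞ ψ → HasCompactSupport ψ →
    tsupport ψ ⊆ (e.target ∩ e.symm ⁻¹' G) ×ˢ Ioo 0 1 →
    ∫ z, (fderiv ℝ ψ z v) • U (e.symm z.1, z.2) =
      - ∫ z, ψ z • DU (e.symm z.1, z.2) (mfderiv (𝓡 d) (𝓡 d) e.symm z.1 v.1, v.2)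

/-- The norm `|L|` of a linear map `L : T_x M × ℝ → F` induced by the metric `g_x + dt²` and the
inner product of `F` (Hilbert–Schmidt norm), computed in an orthonormal basis. -/
def derivNorm {x : M} (L : TangentSpace (𝓡 d) x × ℝ →ₗ[ℝ] F) : ℝ :=
  √((∑ i, ‖L (stdOrthonormalBasis ℝ (TangentSpace (𝓡 d) x) i, 0)‖ ^ 2) + ‖L (0, 1)‖ ^ 2)

variable [MeasurableSpace M]

/-- The integral `∫_{G × (0,1)} |DU|^p`. -/
def derivEnergy (p : ℝ) (G : Set M)
    (DU : (q : M × ℝ) → TangentSpace (𝓡 d) q.1 × ℝ →ₗ[ℝ] F) : ℝ≥0∞ :=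
  ∫⁻ q in G ×ˢ Ioo 0 1, ENNReal.ofReal (derivNorm (DU q) ^ p)
    ∂((riemannianVolume d M).prod volume)

variable (d) in
/-- `u : G → F` is the trace on `G = G × {0}` of `U : G × [0,1) → F`: on every compact
subset `K` of `G`, the means over `t ∈ (0, ε)` of the `L¹(K)`-distances between `U(·, t)` and `u`
tend to `0` as `ε → 0`. This is the classical trace: it is unique almost everywhere and is the
restriction of `U` to `G × {0}` if `U` is continuous on `G × [0,1)`. -/
def IsTrace (G : Set M) (U : M × ℝ → F) (u : M → F) : Prop :=
  ∀ K ⊆ G, IsCompact K → Tendsto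
    (fun ε : ℝ => (ENNReal.ofReal ε)⁻¹ *
      ∫⁻ q in K ×ˢ Ioo 0 ε, ‖U q - u q.1‖ₑ ∂((riemannianVolume d M).prod volume))
    (𝓝[>] 0) (𝓝 0)

/-! ### Maps into a manifold `N`, isometrically embedded by `ι : N → F` -/

variable {N : Type*}

variable (d) in
/-- The energy `∫_{G × (0,1)} |DU|^p` of `U : G × (0,1) → N`, where `DU` is the (almost everywhere
unique) weak derivative of `U`; it is `∞` if `U` is not weakly differentiable. -/
def energy (p : ℝ) (ι : N → F) (G : Set M) (U : M × ℝ → N) : ℝ≥0∞ :=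
  ⨅ (DU : (q : M × ℝ) → TangentSpace (𝓡 d) q.1 × ℝ →ₗ[ℝ] F) (_ : HasWeakDeriv G (ι ∘ U) DU),
    derivEnergy p G DU

variable (d) in
/-- Membership of `U` in the homogeneous Sobolev space `Ẇ^{1,p}(G × [0,1), N)`. -/
def MemSobolev (p : ℝ) (ι : N → F) (G : Set M) (U : M × ℝ → N) : Prop :=
  ∃ DU : (q : M × ℝ) → TangentSpace (𝓡 d) q.1 × ℝ →ₗ[ℝ] F,
    HasWeakDeriv G (ι ∘ U) DU ∧ derivEnergy p G DU < ⊤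

variable (d) in
/-- `u|_G` belongs to `tr_G (Ẇ^{1,p}(G × [0,1), N))`. -/
def MemTraceSpace (p : ℝ) (ι : N → F) (G : Set M) (u : M → N) : Prop :=
  ∃ U : M × ℝ → N, MemSobolev d p ι G U ∧ IsTrace d G (ι ∘ U) (ι ∘ u)

variable (d) in
/-- The Sobolev extension energy of `u|_G` for extensions to `G × [0,1)`; it is `∞` if there is no
extension. -/
def extensionEnergy (p : ℝ) (ι : N → F) (G : Set M) (u : M → N) : ℝ≥0∞ :=
  ⨅ (U : M × ℝ → N) (_ : MemSobolev d p ι G U ∧ IsTrace d G (ι ∘ U) (ι ∘ u)), energy d p ι G U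

end Riemannian

/-- `ι : N → ℝ^ν` is a smooth isometric embedding of Riemannian manifolds. -/
structure IsIsometricEmbedding {n ν : ℕ} {N : Type*} [TopologicalSpace N]
    [ChartedSpace (EuclideanSpace ℝ (Fin n)) N]
    [RiemannianBundle (fun y : N => TangentSpace (𝓡 n) y)]
    (ι : N → EuclideanSpace ℝ (Fin ν)) : Prop where
  contMDiff : ContMDiff (𝓡 n) (𝓡 ν) ∞ ι
  isEmbedding : IsEmbedding ι
  inner_mfderiv : ∀ (y : N) (v w : TangentSpace (𝓡 n) y),
    inner ℝ (mfderiv (𝓡 n) (𝓡 ν) ι y v) (mfderiv (𝓡 n) (𝓡 ν) ι y w) = inner ℝ v w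

end Collar

end

/-!
Let `h ≥ 0` be a smooth function on `M`, and let `U₁` and `U₂` be two extensions of the same map
`u`, to the collars of two open sets `A` and `B`. They are combined by the *fold* `V`:
over each `x`, the map `V(x, ·)` runs along `U₂(x, ·)` from the height `0` to the height `h x / 2`,
back along `U₂(x, ·)` to the height `0`, and then along `U₁(x, ·)`:

* `V(x, t) = U₂(x, t)` for `t ≤ h x / 2`,
* `V(x, t) = U₂(x, h x - t)` for `h x / 2 < t ≤ h x`,
* `V(x, t) = U₁(x, t - h x)` for `h x < t`.

All values of `V` are values of `U₁` and `U₂`, so `V` takes its values in the target manifold `N`: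
there is neither averaging nor projection to `N`, and thus no dependence on the geometry of `N`.
If `0 ≤ t < 1`, then `U₁` enters over `x` only where `h x < 1`, and `U₂` only where `h x > 0`.
Therefore, if `C` is open and `closure C ⊆ A ∪ B`, and if `h` vanishes near `closure C \ B` and is
`2` near `closure C \ A`, then `V` is defined on the collar of `C`.

The three pieces of `V` are compositions of `U₁` and `U₂` with shears `(x, t) ↦ (x, ± t + k x)`,
which preserve the product measure (`measurePreserving_shear`) and change the norm of a derivative
at most by a factor that depends on a bound for `dh` (`derivNorm_comp_shearLin_le`). So the energy
of `V` is at most `c (E(U₁) + 2 E(U₂))`, where `c` depends on `p`, the dimension and `h` alone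
(`derivEnergy_foldDeriv_le`), and by the same decomposition `V` has the trace `u`
(`IsTrace.fold`).

It remains to see that `V` is weakly differentiable (`HasWeakDeriv.fold`). In a chart, this holds
off the graphs of `h / 2` and `h` by the chain rule for shears (`IsWeakDeriv.comp_shear`). Across a
graph it holds if the traces from the two sides agree (`IsWeakDeriv.glue`): one multiplies the test
function by cutoffs that vanish near the graph, and the derivative of the cutoffs is odd under the
reflection in the graph, which leaves an integral of the difference of `V` and its reflection
(`tendsto_integral_deriv_cutoff`). At the graph of `h / 2` the fold is symmetric, and at the graph
of `h` both traces are `u`. The trace condition on `M` passes to charts because the Riemannian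
volume bounds the Lebesgue measure on compact subsets of a chart (`exists_volume_inter_le`).

An induction over the covering, in which the part of `C` outside of one of the sets is first
enclosed in an open set whose closure is still covered by the others, gives the result for finitely
many sets (`exists_hasExtension_of_closure_subset_iUnion`).
-/

namespace Collar

/-! ### Shears of a product with the line -/

section Shear

variable {X : Type*}

/-- The fibrewise affine map `(x, t) ↦ (x, σ t + k x)` of `X × ℝ`, for a sign `σ`: a shear if
`σ = 1`, and a reflection in the graph of `k / 2` if `σ = -1`. -/
def shear (σ : ℝ) (k : X → ℝ) (q : X × ℝ) : X × ℝ := (q.1, σ * q.2 + k q.1)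

lemma shear_inv_shear {σ : ℝ} (hσ : σ * σ = 1) (k : X → ℝ) (q : X × ℝ) :
    shear σ (fun x => -(σ * k x)) (shear σ k q) = q := by
  ext
  · rfl
  · simp only [shear]; linear_combination q.2 * hσ

lemma shear_shear_inv {σ : ℝ} (hσ : σ * σ = 1) (k : X → ℝ) (q : X × ℝ) :
    shear σ k (shear σ (fun x => -(σ * k x)) q) = q := by
  ext
  · rfl
  · simp only [shear]; linear_combination (q.2 - k q.1) * hσ

variable [MeasurableSpace X]

lemma measurable_shear (σ : ℝ) {k : X → ℝ} (hk : Measurable k) : Measurable (shear σ k) := by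
  unfold shear; fun_prop

/-- The shear as a measurable equivalence. -/
def shearEquiv {σ : ℝ} (hσ : σ * σ = 1) {k : X → ℝ} (hk : Measurable k) : X × ℝ ≃ᵐ X × ℝ where
  toFun := shear σ k
  invFun := shear σ (fun x => -(σ * k x))
  left_inv := shear_inv_shear hσ k
  right_inv := shear_shear_inv hσ k
  measurable_toFun := measurable_shear σ hk
  measurable_invFun := measurable_shear σ (k := fun x => -(σ * k x)) (by fun_prop)

lemma measurableEmbedding_shear {σ : ℝ} (hσ : σ * σ = 1) {k : X → ℝ} (hk : Measurable k) :
    MeasurableEmbedding (shear σ k) :=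
  (shearEquiv hσ hk).measurableEmbedding

/-- Shears preserve `μ × dt` for an arbitrary measure `μ`: the finiteness of `μ` plays no role,
since only the integration over the fibres `ℝ` comes first. -/
lemma measurePreserving_shear (μ : Measure X) {σ : ℝ} (hσ : σ * σ = 1) {k : X → ℝ}
    (hk : Measurable k) :
    MeasurePreserving (shear σ k) (μ.prod volume) (μ.prod volume) := by
  refine ⟨measurable_shear σ hk, ?_⟩
  ext s hs
  rw [Measure.map_apply (measurable_shear σ hk) hs, Measure.prod_apply hs,
    Measure.prod_apply (measurable_shear σ hk hs)]
  refine lintegral_congr fun x => ?_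
  have h : MeasurePreserving (fun t : ℝ => σ * t + k x) volume volume := by
    rcases mul_self_eq_one_iff.1 hσ with rfl | rfl
    · simpa using measurePreserving_add_right volume (k x)
    · simpa [sub_eq_neg_add] using Measure.measurePreserving_sub_left volume (k x)
  have := h.measure_preimage (s := Prod.mk x ⁻¹' s) (measurable_prodMk_left hs).nullMeasurableSet
  rw [← this]; rfl

lemma measurePreserving_shear_volume {Y : Type*} [MeasureSpace Y] {σ : ℝ} (hσ : σ * σ = 1)
    {k : Y → ℝ} (hk : Measurable k) :
    MeasurePreserving (shear σ k) (volume : Measure (Y × ℝ)) volume :=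
  measurePreserving_shear volume hσ hk

lemma setLIntegral_shear_le (μ : Measure X) {σ : ℝ} (hσ : σ * σ = 1) {k : X → ℝ}
    (hk : Measurable k) {S T : Set (X × ℝ)} (hST : MapsTo (shear σ k) S T)
    (f : X × ℝ → ℝ≥0∞) :
    ∫⁻ q in S, f (shear σ k q) ∂(μ.prod volume) ≤ ∫⁻ q in T, f q ∂(μ.prod volume) :=
  calc _ ≤ ∫⁻ q in shear σ k ⁻¹' T, f (shear σ k q) ∂(μ.prod volume) :=
        lintegral_mono_set hST
    _ = _ := (measurePreserving_shear μ hσ hk).setLIntegral_comp_preimage_emb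
        (measurableEmbedding_shear hσ hk) f T

/-- The graph of a measurable function is a null set. -/
lemma measure_graph (μ : Measure X) {k : X → ℝ} (hk : Measurable k) :
    (μ.prod volume) {q : X × ℝ | q.2 = k q.1} = 0 := by
  have h : MeasurableSet {q : X × ℝ | q.2 = k q.1} :=
    measurableSet_eq_fun measurable_snd (hk.comp measurable_fst)
  rw [Measure.prod_apply h]
  simp

/-- The integral estimate for the folded map: `X × ℝ` is cut along the graphs of `k / 2` and `k`,
and each part is sheared back. -/
lemma setLIntegral_fold_le (μ : Measure X) {k : X → ℝ} (hk : Measurable k)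
    {S T₁ T₂ : Set (X × ℝ)} {f f₁ f₂ : X × ℝ → ℝ≥0∞} (hS : MeasurableSet S)
    (h₁ : ∀ x t, (x, t) ∈ S → k x < t → (x, t - k x) ∈ T₁ ∧ f (x, t) ≤ f₁ (x, t - k x))
    (h₂ : ∀ x t, (x, t) ∈ S → k x / 2 < t → t < k x →
      (x, k x - t) ∈ T₂ ∧ f (x, t) ≤ f₂ (x, k x - t))
    (h₃ : ∀ x t, (x, t) ∈ S → t ≤ k x / 2 → (x, t) ∈ T₂ ∧ f (x, t) ≤ f₂ (x, t)) :
    ∫⁻ q in S, f q ∂(μ.prod volume) ≤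
      ∫⁻ q in T₁, f₁ q ∂(μ.prod volume) + 2 * ∫⁻ q in T₂, f₂ q ∂(μ.prod volume) := by
  set S₁ := S ∩ {q : X × ℝ | k q.1 < q.2}
  set S₂ := S ∩ {q : X × ℝ | k q.1 / 2 < q.2 ∧ q.2 < k q.1}
  set S₃ := S ∩ {q : X × ℝ | q.2 ≤ k q.1 / 2}
  set S₄ := {q : X × ℝ | q.2 = k q.1}
  have m₁ : MeasurableSet S₁ :=
    hS.inter (measurableSet_lt (hk.comp measurable_fst) measurable_snd)
  have m₂ : MeasurableSet S₂ :=
    hS.inter ((measurableSet_lt ((hk.comp measurable_fst).div_const 2) measurable_snd).inter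
      (measurableSet_lt measurable_snd (hk.comp measurable_fst)))
  have m₃ : MeasurableSet S₃ :=
    hS.inter (measurableSet_le measurable_snd ((hk.comp measurable_fst).div_const 2))
  have hcov : S ⊆ (S₁ ∪ (S₂ ∪ S₃)) ∪ S₄ := by
    rintro q hq
    simp only [S₁, S₂, S₃, S₄, mem_union, mem_inter_iff, mem_ofPred_eq, hq, true_and]
    rcases lt_trichotomy q.2 (k q.1) with h | h | h
    · rcases lt_or_ge (k q.1 / 2) q.2 with h' | h'
      · exact Or.inl (Or.inr (Or.inl ⟨h', h⟩))
      · exact Or.inl (Or.inr (Or.inr h'))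
    · exact Or.inr h
    · exact Or.inl (Or.inl h)
  have e₁ : ∫⁻ q in S₁, f q ∂(μ.prod volume) ≤ ∫⁻ q in T₁, f₁ q ∂(μ.prod volume) := by
    refine le_trans (setLIntegral_mono' m₁ (g := fun q => f₁ (shear 1 (fun x => -k x) q)) ?_)
      (setLIntegral_shear_le μ (by norm_num) hk.neg ?_ f₁)
    · rintro ⟨x, t⟩ ⟨hq, hq'⟩
      simpa [shear, sub_eq_add_neg] using (h₁ x t hq hq').2
    · rintro ⟨x, t⟩ ⟨hq, hq'⟩
      simpa [shear, sub_eq_add_neg] using (h₁ x t hq hq').1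
  have e₂ : ∫⁻ q in S₂, f q ∂(μ.prod volume) ≤ ∫⁻ q in T₂, f₂ q ∂(μ.prod volume) := by
    refine le_trans (setLIntegral_mono' m₂ (g := fun q => f₂ (shear (-1) k q)) ?_)
      (setLIntegral_shear_le μ (by norm_num) hk ?_ f₂)
    · rintro ⟨x, t⟩ ⟨hq, hq'⟩
      simpa [shear, sub_eq_neg_add] using (h₂ x t hq hq'.1 hq'.2).2
    · rintro ⟨x, t⟩ ⟨hq, hq'⟩
      simpa [shear, sub_eq_neg_add] using (h₂ x t hq hq'.1 hq'.2).1
  have e₃ : ∫⁻ q in S₃, f q ∂(μ.prod volume) ≤ ∫⁻ q in T₂, f₂ q ∂(μ.prod volume) :=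
    (setLIntegral_mono' m₃ fun q hq => (h₃ q.1 q.2 hq.1 hq.2).2).trans
      (lintegral_mono_set fun q hq => (h₃ q.1 q.2 hq.1 hq.2).1)
  have e₄ : ∫⁻ q in S₄, f q ∂(μ.prod volume) = 0 :=
    setLIntegral_measure_zero _ _ (measure_graph μ hk)
  calc ∫⁻ q in S, f q ∂(μ.prod volume)
      ≤ ∫⁻ q in (S₁ ∪ (S₂ ∪ S₃)) ∪ S₄, f q ∂(μ.prod volume) := lintegral_mono_set hcov
    _ ≤ (∫⁻ q in S₁, f q ∂(μ.prod volume) + (∫⁻ q in S₂, f q ∂(μ.prod volume) +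
          ∫⁻ q in S₃, f q ∂(μ.prod volume))) + ∫⁻ q in S₄, f q ∂(μ.prod volume) := by
        refine (lintegral_union_le _ _ _).trans ?_
        gcongr
        refine (lintegral_union_le _ _ _).trans ?_
        gcongr
        exact lintegral_union_le _ _ _
    _ ≤ _ := by
        rw [e₄, add_zero, two_mul]
        gcongr

end Shear

/-! ### Weak derivatives on open subsets of `E × ℝ` -/

section WeakDeriv

variable {E F : Type*} [NormedAddCommGroup E] [InnerProductSpace ℝ E]
  [NormedAddCommGroup F] [NormedSpace ℝ F]

lemma continuous_fderiv_apply_const {φ : E × ℝ → ℝ} (hφ : ContDiff ℝ ∞ φ) (v : E × ℝ) :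
    Continuous fun z => fderiv ℝ φ z v :=
  (hφ.continuous_fderiv (by simp)).clm_apply continuous_const

lemma tsupport_fderiv_apply_subset (φ : E × ℝ → ℝ) (v : E × ℝ) :
    tsupport (fun z => fderiv ℝ φ z v) ⊆ tsupport φ :=
  closure_minimal (fun z hz => by
    refine support_fderiv_subset ℝ (f := φ) (fun h => hz ?_)
    simp [h]) (isClosed_tsupport φ)

variable [FiniteDimensional ℝ E] [MeasurableSpace E] [BorelSpace E]

/-- `g` is the weak derivative of `f` on the open subset `O` of the vector space `E × ℝ`; the value
`g z v` is the derivative in the direction `v` at the point `z`. -/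
structure IsWeakDeriv (O : Set (E × ℝ)) (f : E × ℝ → F) (g : E × ℝ → E × ℝ →ₗ[ℝ] F) : Prop where
  locallyIntegrableOn : LocallyIntegrableOn f O
  locallyIntegrableOn_deriv : ∀ v, LocallyIntegrableOn (fun z => g z v) O
  integral_eq : ∀ v, ∀ ψ : E × ℝ → ℝ, ContDiff ℝ ∞ ψ → HasCompactSupport ψ → tsupport ψ ⊆ O →
    ∫ z, (fderiv ℝ ψ z v) • f z = - ∫ z, ψ z • g z v

lemma integrable_smul_of_tsupport_subset {O : Set (E × ℝ)} {f : E × ℝ → F} {φ : E × ℝ → ℝ}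
    (hf : LocallyIntegrableOn f O) (hφ : Continuous φ) (hc : HasCompactSupport φ)
    (hs : tsupport φ ⊆ O) : Integrable (fun z => φ z • f z) := by
  have h : IntegrableOn (fun z => φ z • f z) (tsupport φ) :=
    (hf.integrableOn_compact_subset hs hc).continuousOn_smul hφ.continuousOn hc
  refine (integrableOn_iff_integrable_of_support_subset ?_).1 h
  exact (Function.support_smul_subset_left _ _).trans (subset_tsupport φ)

lemma integrable_fderiv_smul {O : Set (E × ℝ)} {f : E × ℝ → F}
    {φ : E × ℝ → ℝ} (h : LocallyIntegrableOn f O)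
    (hφ : ContDiff ℝ ∞ φ) (hc : HasCompactSupport φ) (hs : tsupport φ ⊆ O) (v : E × ℝ) :
    Integrable (fun z => (fderiv ℝ φ z v) • f z) :=
  integrable_smul_of_tsupport_subset h (continuous_fderiv_apply_const hφ v)
    (hc.of_isClosed_subset (isClosed_tsupport _) (tsupport_fderiv_apply_subset φ v))
    ((tsupport_fderiv_apply_subset φ v).trans hs)

lemma IsWeakDeriv.mono {O O' : Set (E × ℝ)} {f : E × ℝ → F} {g : E × ℝ → E × ℝ →ₗ[ℝ] F}
    (h : IsWeakDeriv O f g) (hO : O' ⊆ O) : IsWeakDeriv O' f g where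
  locallyIntegrableOn := h.locallyIntegrableOn.mono_set hO
  locallyIntegrableOn_deriv v := (h.locallyIntegrableOn_deriv v).mono_set hO
  integral_eq v ψ hψ hc hs := h.integral_eq v ψ hψ hc (hs.trans hO)

lemma IsWeakDeriv.congr {O : Set (E × ℝ)} (hO : IsOpen O) {f f' : E × ℝ → F}
    {g g' : E × ℝ → E × ℝ →ₗ[ℝ] F} (h : IsWeakDeriv O f g) (hf : ∀ z ∈ O, f' z = f z)
    (hg : ∀ z ∈ O, ∀ v, g' z v = g z v) : IsWeakDeriv O f' g' where
  locallyIntegrableOn := h.locallyIntegrableOn.congr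
    ((ae_restrict_iff' hO.measurableSet).2 (ae_of_all _ fun z hz => (hf z hz).symm))
  locallyIntegrableOn_deriv v := (h.locallyIntegrableOn_deriv v).congr
    ((ae_restrict_iff' hO.measurableSet).2 (ae_of_all _ fun z hz => (hg z hz v).symm))
  integral_eq v ψ hψ hc hs := by
    have e₁ : ∀ z, (fderiv ℝ ψ z v) • f' z = (fderiv ℝ ψ z v) • f z := fun z => by
      by_cases hz : z ∈ tsupport ψ
      · rw [hf z (hs hz)]
      · have : fderiv ℝ ψ z v = 0 := by
          by_contra h0
          exact hz (tsupport_fderiv_apply_subset ψ v (subset_closure h0))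
        simp [this]
    have e₂ : ∀ z, ψ z • g' z v = ψ z • g z v := fun z => by
      by_cases hz : z ∈ tsupport ψ
      · rw [hg z (hs hz)]
      · simp [image_eq_zero_of_notMem_tsupport hz]
    simp_rw [e₁, e₂]
    exact h.integral_eq v ψ hψ hc hs

/-- Being a weak derivative is a local property. -/
lemma IsWeakDeriv.of_local {O : Set (E × ℝ)} {f : E × ℝ → F} {g : E × ℝ → E × ℝ →ₗ[ℝ] F}
    (h : ∀ z ∈ O, ∃ O', IsOpen O' ∧ z ∈ O' ∧ IsWeakDeriv O' f g) : IsWeakDeriv O f g where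
  locallyIntegrableOn z hz := by
    obtain ⟨O', ho, hz', h'⟩ := h z hz
    have := h'.locallyIntegrableOn z hz'
    rw [ho.nhdsWithin_eq hz'] at this
    exact this.filter_mono nhdsWithin_le_nhds
  locallyIntegrableOn_deriv v z hz := by
    obtain ⟨O', ho, hz', h'⟩ := h z hz
    have := h'.locallyIntegrableOn_deriv v z hz'
    rw [ho.nhdsWithin_eq hz'] at this
    exact this.filter_mono nhdsWithin_le_nhds
  integral_eq v ψ hψ hc hs := by
    choose! N hN hzN hWN using h
    obtain ⟨t, ht⟩ := hc.elim_finite_subcover (fun z : O => N z) (fun z => hN z z.2)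
      (fun z hz => mem_iUnion.2 ⟨⟨z, hs hz⟩, hzN z (hs hz)⟩)
    obtain ⟨ρ, hρ⟩ := SmoothPartitionOfUnity.exists_isSubordinate 𝓘(ℝ, E × ℝ)
      (isClosed_tsupport ψ) (fun z : t => N z.1) (fun z => hN _ z.1.2)
      (fun z hz => by
        obtain ⟨x, hx, hz⟩ := mem_iUnion₂.1 (ht hz)
        exact mem_iUnion.2 ⟨⟨x, hx⟩, hz⟩)
    have hsum : ∀ z ∈ tsupport ψ, ∑ i, ρ i z = 1 := fun z hz => by
      rw [← ρ.sum_eq_one hz, finsum_eq_sum_of_fintype]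
    have hρs : ∀ i, ContDiff ℝ ∞ (ρ i) := fun i => (ρ i).contMDiff.contDiff
    set φ : t → E × ℝ → ℝ := fun i z => ρ i z * ψ z
    have hφ : ∀ i, ContDiff ℝ ∞ (φ i) := fun i => (hρs i).mul hψ
    have hφc : ∀ i, HasCompactSupport (φ i) := fun i => hc.mul_left
    have hφs : ∀ i, tsupport (φ i) ⊆ N i.1 := fun i =>
      (tsupport_mul_subset_left).trans (hρ i)
    have hψφ : ψ = fun z => ∑ i, φ i z := by
      ext z
      rw [← Finset.sum_mul]
      by_cases hz : z ∈ tsupport ψ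
      · rw [hsum z hz, one_mul]
      · rw [image_eq_zero_of_notMem_tsupport hz, mul_zero]
    have e₁ : ∀ z, (fderiv ℝ ψ z v) • f z = ∑ i, (fderiv ℝ (φ i) z v) • f z := fun z => by
      conv_lhs => rw [hψφ]
      rw [fderiv_fun_sum fun i _ => ((hφ i).differentiable (by simp)) z,
        sum_apply, Finset.sum_smul]
    have e₂ : ∀ z, ψ z • g z v = ∑ i, φ i z • g z v := fun z => by
      conv_lhs => rw [hψφ]
      rw [Finset.sum_smul]
    simp_rw [e₁, e₂]
    rw [integral_finsetSum, integral_finsetSum, ← Finset.sum_neg_distrib]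
    · exact Finset.sum_congr rfl fun i _ =>
        (hWN _ i.1.2).integral_eq v (φ i) (hφ i) (hφc i) (hφs i)
    · exact fun i _ => integrable_smul_of_tsupport_subset
        ((hWN _ i.1.2).locallyIntegrableOn_deriv v) (hφ i).continuous (hφc i) (hφs i)
    · exact fun i _ => integrable_fderiv_smul
        ((hWN _ i.1.2).locallyIntegrableOn) (hφ i) (hφc i) (hφs i) v

end WeakDeriv

/-! ### Weak derivatives and shears -/

section ShearLin

variable {V : Type*} [AddCommGroup V] [Module ℝ V]

/-- The derivative `(w, τ) ↦ (w, σ τ + ℓ w)` of a shear `(x, t) ↦ (x, σ t + k x)` at a point where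
the derivative of `k` is `ℓ`. -/
def shearLin (σ : ℝ) (ℓ : V →ₗ[ℝ] ℝ) : V × ℝ →ₗ[ℝ] V × ℝ :=
  (LinearMap.fst ℝ V ℝ).prod (σ • LinearMap.snd ℝ V ℝ + ℓ ∘ₗ LinearMap.fst ℝ V ℝ)

lemma shearLin_apply (σ : ℝ) (ℓ : V →ₗ[ℝ] ℝ) (v : V × ℝ) :
    shearLin σ ℓ v = (v.1, σ * v.2 + ℓ v.1) := by
  simp [shearLin]

end ShearLin

section WeakDeriv

variable {E F : Type*} [NormedAddCommGroup E] [InnerProductSpace ℝ E] [NormedAddCommGroup F]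

lemma contDiff_shear (σ : ℝ) {k : E → ℝ} (hk : ContDiff ℝ ∞ k) : ContDiff ℝ ∞ (shear σ k) := by
  unfold shear; fun_prop

lemma hasFDerivAt_shear (σ : ℝ) {k : E → ℝ} (hk : ContDiff ℝ ∞ k) (z : E × ℝ) :
    HasFDerivAt (shear σ k) ((ContinuousLinearMap.fst ℝ E ℝ).prod
      (σ • ContinuousLinearMap.snd ℝ E ℝ +
        (fderiv ℝ k z.1).comp (ContinuousLinearMap.fst ℝ E ℝ))) z := by
  refine HasFDerivAt.prodMk hasFDerivAt_fst ((hasFDerivAt_snd.const_mul σ).add ?_)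
  exact ((hk.differentiable (by simp)) z.1).hasFDerivAt.comp z hasFDerivAt_fst

variable [FiniteDimensional ℝ E] [MeasurableSpace E] [BorelSpace E]

lemma locallyIntegrableOn_comp_shear {O : Set (E × ℝ)} (hO : IsOpen O) {f : E × ℝ → F}
    (h : LocallyIntegrableOn f O) {σ : ℝ} (hσ : σ * σ = 1) {k : E → ℝ} (hk : ContDiff ℝ ∞ k) :
    LocallyIntegrableOn (f ∘ shear σ k) (shear σ k ⁻¹' O) := by
  have hc := (contDiff_shear σ hk).continuous
  rw [locallyIntegrableOn_iff (hO.preimage hc).isLocallyClosed]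
  intro K hK hKc
  have := h.integrableOn_compact_subset (image_subset_iff.2 hK) (hKc.image hc)
  rwa [(measurePreserving_shear_volume hσ hk.continuous.measurable).integrableOn_image
    (measurableEmbedding_shear hσ hk.continuous.measurable)] at this

variable [NormedSpace ℝ F]

lemma integral_comp_shear {σ : ℝ} (hσ : σ * σ = 1) {k : E → ℝ} (hk : Measurable k)
    (H : E × ℝ → F) : ∫ z, H (shear σ k z) = ∫ z, H z :=
  (measurePreserving_shear_volume hσ hk).integral_comp (measurableEmbedding_shear hσ hk) H

/-- The chain rule for the composition of a weakly differentiable function with a shear. -/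
lemma IsWeakDeriv.comp_shear {O : Set (E × ℝ)} (hO : IsOpen O) {f : E × ℝ → F}
    {g : E × ℝ → E × ℝ →ₗ[ℝ] F} (h : IsWeakDeriv O f g) {σ : ℝ} (hσ : σ * σ = 1) {k : E → ℝ}
    (hk : ContDiff ℝ ∞ k) :
    IsWeakDeriv (shear σ k ⁻¹' O) (f ∘ shear σ k)
      (fun z => g (shear σ k z) ∘ₗ shearLin σ (fderiv ℝ k z.1 : E →ₗ[ℝ] ℝ)) := by
  have hc := (contDiff_shear σ hk).continuous
  have hkm := hk.continuous.measurable
  have hkd : ∀ v : E, ContDiff ℝ ∞ fun z : E × ℝ => fderiv ℝ k z.1 v := fun v =>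
    ((hk.fderiv_right (m := ∞) (by simp)).clm_apply contDiff_const).comp contDiff_fst
  have hsplit : ∀ (v : E × ℝ) (z : E × ℝ) (L : E × ℝ →ₗ[ℝ] F),
      L (v.1, σ * v.2 + fderiv ℝ k z.1 v.1) =
        L (v.1, σ * v.2) + (fderiv ℝ k z.1 v.1) • L (0, 1) := fun v z L => by
    rw [← map_smul, ← map_add]; simp
  refine ⟨locallyIntegrableOn_comp_shear hO h.locallyIntegrableOn hσ hk, fun v => ?_,
    fun v ψ hψ hψc hψs => ?_⟩
  · have h₁ := locallyIntegrableOn_comp_shear hO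
      (h.locallyIntegrableOn_deriv (v.1, σ * v.2)) hσ hk
    have h₂ := locallyIntegrableOn_comp_shear hO (h.locallyIntegrableOn_deriv (0, 1)) hσ hk
    have h₃ : LocallyIntegrableOn (fun z : E × ℝ => (fderiv ℝ k z.1 v.1) •
        g (shear σ k z) (0, 1)) (shear σ k ⁻¹' O) := by
      rw [locallyIntegrableOn_iff (hO.preimage hc).isLocallyClosed] at h₂ ⊢
      exact fun K hK hKc => (h₂ K hK hKc).continuousOn_smul (hkd v.1).continuous.continuousOn hKc
    refine (h₁.add h₃).congr (ae_of_all _ fun z => ?_)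
    simp only [Pi.add_apply, Function.comp_apply, LinearMap.comp_apply, shearLin_apply,
      ContinuousLinearMap.coe_coe]
    exact (hsplit v z _).symm
  · set Ψ : E × ℝ → E × ℝ := shear σ (fun x => -(σ * k x))
    have hΨ : ContDiff ℝ ∞ Ψ := contDiff_shear σ (by fun_prop)
    have hΨΦ : ∀ z, Ψ (shear σ k z) = z := shear_inv_shear hσ k
    have hΦΨ : ∀ z, shear σ k (Ψ z) = z := shear_shear_inv hσ k
    set φ : E × ℝ → ℝ := ψ ∘ Ψ
    have hφ : ContDiff ℝ ∞ φ := hψ.comp hΨ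
    have hφK : ∀ z ∉ shear σ k '' tsupport ψ, φ z = 0 := fun z hz =>
      image_eq_zero_of_notMem_tsupport (f := ψ) (x := Ψ z) fun h' => hz ⟨Ψ z, h', hΦΨ z⟩
    have hKc : IsCompact (shear σ k '' tsupport ψ) := hψc.image hc
    have hφc : HasCompactSupport φ := HasCompactSupport.intro hKc hφK
    have hφs : tsupport φ ⊆ O :=
      (closure_minimal (fun z (hz : φ z ≠ 0) => by_contra fun h' => hz (hφK z h'))
        hKc.isClosed).trans (image_subset_iff.2 hψs)
    set κ : E × ℝ → ℝ := fun z => fderiv ℝ k z.1 v.1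
    have hκ : ContDiff ℝ ∞ κ := hkd v.1
    set φ' : E × ℝ → ℝ := fun z => κ z * φ z
    have hφ' : ContDiff ℝ ∞ φ' := hκ.mul hφ
    have hφ'c : HasCompactSupport φ' := hφc.mul_left
    have hφ's : tsupport φ' ⊆ O := tsupport_mul_subset_right.trans hφs
    -- `κ` does not depend on the last coordinate
    have hDφ' : ∀ z, fderiv ℝ φ' z (0, 1) = κ z * fderiv ℝ φ z (0, 1) := fun z => by
      have e : HasFDerivAt κ ((fderiv ℝ (fun y => fderiv ℝ k y v.1) z.1).comp
          (ContinuousLinearMap.fst ℝ E ℝ)) z := by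
        have e' : Differentiable ℝ fun y => fderiv ℝ k y v.1 :=
          ((hk.fderiv_right (m := ∞) (by simp)).clm_apply contDiff_const).differentiable (by simp)
        exact (e' z.1).hasFDerivAt.comp z hasFDerivAt_fst
      have : fderiv ℝ φ' z = _ := (e.mul ((hφ.differentiable (by simp)) z).hasFDerivAt).fderiv
      rw [this]; simp
    have hDψ : ∀ z, fderiv ℝ ψ z v =
        fderiv ℝ φ (shear σ k z) (v.1, σ * v.2) + fderiv ℝ φ' (shear σ k z) (0, 1) := fun z => by
      have e₁ : ψ = φ ∘ shear σ k := by ext z; simp only [φ, Function.comp_apply, hΨΦ]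
      have e₂ := (((hφ.differentiable (by simp)) (shear σ k z)).hasFDerivAt.comp z
        (hasFDerivAt_shear σ hk z)).fderiv
      rw [← e₁] at e₂
      rw [e₂, hDφ', ← smul_eq_mul (a := κ _), ← map_smul, ← map_add]
      simp [κ, shear]
    calc ∫ z, (fderiv ℝ ψ z v) • (f ∘ shear σ k) z
        = ∫ z, (fun w => (fderiv ℝ φ w (v.1, σ * v.2)) • f w + (fderiv ℝ φ' w (0, 1)) • f w)
            (shear σ k z) := by
          refine integral_congr_ae (ae_of_all _ fun z => ?_)
          simp only [Function.comp_apply, hDψ z, add_smul]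
      _ = ∫ w, (fderiv ℝ φ w (v.1, σ * v.2)) • f w + (fderiv ℝ φ' w (0, 1)) • f w :=
          integral_comp_shear hσ hkm
            (fun w => (fderiv ℝ φ w (v.1, σ * v.2)) • f w + (fderiv ℝ φ' w (0, 1)) • f w)
      _ = - ∫ w, (φ w • g w (v.1, σ * v.2) + φ' w • g w (0, 1)) := by
          rw [integral_add, integral_add, h.integral_eq _ φ hφ hφc hφs,
            h.integral_eq _ φ' hφ' hφ'c hφ's, neg_add]
          · exact integrable_smul_of_tsupport_subset (h.locallyIntegrableOn_deriv _)
              hφ.continuous hφc hφs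
          · exact integrable_smul_of_tsupport_subset (h.locallyIntegrableOn_deriv _)
              hφ'.continuous hφ'c hφ's
          · exact integrable_fderiv_smul h.locallyIntegrableOn hφ hφc hφs _
          · exact integrable_fderiv_smul h.locallyIntegrableOn hφ' hφ'c hφ's _
      _ = - ∫ z, (fun w => φ w • g w (v.1, σ * v.2) + φ' w • g w (0, 1)) (shear σ k z) := by
          rw [integral_comp_shear hσ hkm
            (fun w => φ w • g w (v.1, σ * v.2) + φ' w • g w (0, 1))]
      _ = _ := by
          congr 1
          refine integral_congr_ae (ae_of_all _ fun z => ?_)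
          simp only [φ, φ', κ, Function.comp_apply, hΨΦ, LinearMap.comp_apply, shearLin_apply,
            ContinuousLinearMap.coe_coe, hsplit, smul_add, smul_smul, mul_comm]
          rfl

end WeakDeriv

/-! ### Gluing along a graph -/

/-- An even smooth cutoff function on the line that vanishes on `[-1, 1]` and is `1` outside of
`(-2, 2)`. -/
noncomputable def cutoff (r : ℝ) : ℝ := Real.smoothTransition (r ^ 2 - 1)

lemma contDiff_cutoff : ContDiff ℝ ∞ cutoff :=
  Real.smoothTransition.contDiff.comp (by fun_prop)

lemma cutoff_eq_zero {r : ℝ} (hr : |r| ≤ 1) : cutoff r = 0 :=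
  Real.smoothTransition.zero_of_nonpos (by nlinarith [sq_abs r, abs_nonneg r])

lemma cutoff_eq_one {r : ℝ} (hr : 3 / 2 ≤ |r|) : cutoff r = 1 :=
  Real.smoothTransition.one_of_one_le (by nlinarith [sq_abs r, abs_nonneg r])

lemma abs_cutoff_le (r : ℝ) : |cutoff r| ≤ 1 := by
  rw [cutoff, abs_of_nonneg (Real.smoothTransition.nonneg _)]
  exact Real.smoothTransition.le_one _

lemma continuous_deriv_cutoff : Continuous (deriv cutoff) :=
  contDiff_cutoff.continuous_deriv (by simp)

lemma deriv_cutoff_eq_zero {r : ℝ} (hr : 2 ≤ |r|) : deriv cutoff r = 0 := by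
  have : cutoff =ᶠ[𝓝 r] fun _ => 1 := by
    filter_upwards [(isOpen_lt continuous_const continuous_abs).mem_nhds
      (show (3 / 2 : ℝ) < |r| by linarith)] with s hs
    exact cutoff_eq_one (le_of_lt hs)
  rw [this.deriv_eq]; simp

lemma deriv_cutoff_neg (r : ℝ) : deriv cutoff (-r) = -deriv cutoff r := by
  have h : (fun x => cutoff (-x)) = cutoff := by ext x; simp [cutoff]
  have := deriv_comp_neg cutoff r
  rw [h] at this
  rw [this, neg_neg]

lemma exists_abs_deriv_cutoff_le : ∃ c : ℝ, ∀ r, |deriv cutoff r| ≤ c := by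
  refine continuous_deriv_cutoff.bounded_above_of_compact_support ?_
  refine HasCompactSupport.intro (isCompact_Icc (a := -2) (b := 2)) fun r hr => ?_
  refine deriv_cutoff_eq_zero ?_
  by_contra! h
  exact hr ⟨(abs_lt.1 h).1.le, (abs_lt.1 h).2.le⟩

section WeakDeriv

variable {E F : Type*} [NormedAddCommGroup E] [InnerProductSpace ℝ E] [FiniteDimensional ℝ E]
  [MeasurableSpace E] [BorelSpace E] [NormedAddCommGroup F] [NormedSpace ℝ F]

/-- The boundary terms that come from cutting off along the graph of `k` vanish in the limit: the
derivative of the cutoff is odd under the reflection in the graph, which matches the traces of `f`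
from the two sides. -/
lemma tendsto_integral_deriv_cutoff {f : E × ℝ → F} {B : ℝ} (hB : ∀ z, ‖f z‖ ≤ B)
    {k : E → ℝ} (hk : ContDiff ℝ ∞ k) {θ : E × ℝ → ℝ} (hθ : ContDiff ℝ ∞ θ)
    (hθc : HasCompactSupport θ) (hθf : ∀ α : E × ℝ → ℝ, Continuous α →
      Integrable fun z => (α z * θ z) • f z)
    (htr : Tendsto (fun δ : ℝ => (ENNReal.ofReal δ)⁻¹ *
      ∫⁻ z in tsupport θ ∩ {z | |z.2 - k z.1| < δ},
        ‖f z - f (shear (-1) (fun y => 2 * k y) z)‖ₑ) (𝓝[>] 0) (𝓝 0)) :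
    Tendsto (fun n : ℕ => ∫ z, (deriv cutoff ((n + 1 : ℝ) * (z.2 - k z.1)) * (n + 1 : ℝ) * θ z) •
      f z) atTop (𝓝 0) := by
  obtain ⟨c, hc⟩ := exists_abs_deriv_cutoff_le
  have hc0 : 0 ≤ c := (abs_nonneg _).trans (hc 0)
  obtain ⟨T, hT⟩ := hθ.continuous.bounded_above_of_compact_support hθc
  have hT0 : 0 ≤ T := (norm_nonneg _).trans (hT 0)
  have hB0 : 0 ≤ B := (norm_nonneg _).trans (hB 0)
  obtain ⟨L, hL⟩ := hθ.lipschitzWith_of_hasCompactSupport hθc (by simp)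
  have hkc := hk.continuous
  have h2k : ContDiff ℝ ∞ fun y => 2 * k y := by fun_prop
  set ρ : E × ℝ → E × ℝ := shear (-1) (fun y => 2 * k y)
  have hρc : Continuous ρ := (contDiff_shear (-1) h2k).continuous
  have hρm : MeasurePreserving ρ volume volume :=
    measurePreserving_shear_volume (by norm_num) h2k.continuous.measurable
  have hρe : MeasurableEmbedding ρ :=
    measurableEmbedding_shear (by norm_num) h2k.continuous.measurable
  set A : ℕ → E × ℝ → ℝ := fun n z => deriv cutoff ((n + 1 : ℝ) * (z.2 - k z.1)) * (n + 1 : ℝ)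
  have hAc : ∀ n, Continuous (A n) := fun n =>
    (continuous_deriv_cutoff.comp (by fun_prop)).mul continuous_const
  have hAρ : ∀ n z, A n (ρ z) = - A n z := fun n z => by
    simp only [A, ρ, shear]
    rw [show (n + 1 : ℝ) * (-1 * z.2 + 2 * k z.1 - k z.1) = -((n + 1 : ℝ) * (z.2 - k z.1)) by ring,
      deriv_cutoff_neg, neg_mul]
  have hA0 : ∀ (n : ℕ) z, 2 / (n + 1 : ℝ) ≤ |z.2 - k z.1| → A n z = 0 := fun n z hz => by
    simp only [A]
    rw [deriv_cutoff_eq_zero, zero_mul]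
    have hn : (0 : ℝ) < n + 1 := by positivity
    rw [abs_mul, abs_of_pos hn]
    rwa [div_le_iff₀' hn] at hz
  have hAle : ∀ (n : ℕ) z, |A n z| ≤ c * (n + 1 : ℝ) := fun n z => by
    simp only [A]
    rw [abs_mul, abs_of_pos (show (0 : ℝ) < n + 1 by positivity)]
    gcongr
    exact hc _
  have hρz : ∀ z, ‖z - ρ z‖ = 2 * |z.2 - k z.1| := fun z => by
    have : z - ρ z = (0, 2 * (z.2 - k z.1)) := by
      ext
      · simp [ρ, shear]
      · simp [ρ, shear]; ring
    rw [this, Prod.norm_mk]; simp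
  have hθρ : ∀ z, |θ z - θ (ρ z)| ≤ L * (2 * |z.2 - k z.1|) := fun z => by
    rw [← hρz, ← Real.norm_eq_abs]; exact hL.norm_sub_le _ _
  set J : ℕ → F := fun n => ∫ z, (A n z * θ z) • f z
  change Tendsto J atTop (𝓝 0)
  have hJ : ∀ n, (2 : ℝ) • J n = ∫ z, A n z • (θ z • f z - θ (ρ z) • f (ρ z)) := fun n => by
    have e₁ : J n = ∫ z, (A n (ρ z) * θ (ρ z)) • f (ρ z) :=
      (hρm.integral_comp hρe fun z => (A n z * θ z) • f z).symm
    have i₁ := hθf (A n) (hAc n)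
    have i₂ : Integrable fun z => (A n (ρ z) * θ (ρ z)) • f (ρ z) :=
      (hρm.integrable_comp_emb hρe (g := fun z => (A n z * θ z) • f z)).2 i₁
    calc (2 : ℝ) • J n = J n + ∫ z, (A n (ρ z) * θ (ρ z)) • f (ρ z) := by rw [← e₁, two_smul]
      _ = ∫ z, ((A n z * θ z) • f z + (A n (ρ z) * θ (ρ z)) • f (ρ z)) := (integral_add i₁ i₂).symm
      _ = _ := by
        refine integral_congr_ae (ae_of_all _ fun z => ?_)
        simp only [hAρ, smul_add, smul_neg, smul_smul, neg_mul, neg_smul, sub_eq_add_neg]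
  set D : ℕ → E × ℝ → ℝ≥0∞ := fun n z => ‖A n z * (θ z - θ (ρ z)) * B‖ₑ
  set W : ℕ → E × ℝ → ℝ≥0∞ := fun n z => ‖A n z * θ z‖ₑ * ‖f z - f (ρ z)‖ₑ
  have hDm : ∀ n, Measurable (D n) := fun n => by
    have : Continuous fun z => A n z * (θ z - θ (ρ z)) * B :=
      (((hAc n).mul (hθ.continuous.sub (hθ.continuous.comp hρc))).mul continuous_const)
    exact this.enorm.measurable
  have hpt : ∀ n z, ‖A n z • (θ z • f z - θ (ρ z) • f (ρ z))‖ₑ ≤ W n z + D n z := fun n z => by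
    have : A n z • (θ z • f z - θ (ρ z) • f (ρ z)) =
        (A n z * θ z) • (f z - f (ρ z)) + (A n z * (θ z - θ (ρ z))) • f (ρ z) := by
      simp only [smul_sub, smul_smul, mul_sub, sub_smul]; abel
    rw [this]
    refine (enorm_add_le _ _).trans ?_
    simp only [W, D, enorm_smul, enorm_mul]
    gcongr
    rw [← ofReal_norm, ← ofReal_norm]
    exact ENNReal.ofReal_le_ofReal ((hB _).trans (Real.le_norm_self _))
  have hW : Tendsto (fun n => ∫⁻ z, W n z) atTop (𝓝 0) := by
    have hδ : Tendsto (fun n : ℕ => 2 / (n + 1 : ℝ)) atTop (𝓝[>] 0) := by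
      refine tendsto_nhdsWithin_iff.2 ⟨?_, Eventually.of_forall fun n => ?_⟩
      · have := (tendsto_one_div_add_atTop_nhds_zero_nat (𝕜 := ℝ)).const_mul 2
        simpa [div_eq_mul_inv] using this
      · exact mem_Ioi.2 (by positivity)
    have h := ENNReal.Tendsto.const_mul (a := ENNReal.ofReal (2 * c * T)) (htr.comp hδ)
      (Or.inr ENNReal.ofReal_ne_top)
    rw [mul_zero] at h
    refine tendsto_of_tendsto_of_tendsto_of_le_of_le tendsto_const_nhds h (fun _ => zero_le)
      fun n => ?_
    set S := tsupport θ ∩ {z : E × ℝ | |z.2 - k z.1| < 2 / (n + 1 : ℝ)}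
    have hS : MeasurableSet S := (isClosed_tsupport θ).measurableSet.inter
      (isOpen_lt (by fun_prop) continuous_const).measurableSet
    have hbound : ∀ z, W n z ≤ S.indicator (fun z => ENNReal.ofReal (c * (n + 1 : ℝ) * T) *
        ‖f z - f (ρ z)‖ₑ) z := fun z => by
      by_cases hz : z ∈ S
      · rw [indicator_of_mem hz]
        simp only [W]
        gcongr
        rw [← ofReal_norm, norm_mul]
        refine ENNReal.ofReal_le_ofReal ?_
        exact mul_le_mul (hAle n z) (hT z) (norm_nonneg _) (by positivity)
      · rw [indicator_of_notMem hz]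
        have : A n z * θ z = 0 := by
          by_cases h1 : z ∈ tsupport θ
          · rw [hA0 n z (not_lt.1 fun h2 => hz ⟨h1, h2⟩), zero_mul]
          · rw [image_eq_zero_of_notMem_tsupport h1, mul_zero]
        simp only [W, this, enorm_zero, zero_mul, le_refl]
    calc ∫⁻ z, W n z ≤ ∫⁻ z, S.indicator (fun z => ENNReal.ofReal (c * (n + 1 : ℝ) * T) *
          ‖f z - f (ρ z)‖ₑ) z := lintegral_mono hbound
      _ = ENNReal.ofReal (c * (n + 1 : ℝ) * T) * ∫⁻ z in S, ‖f z - f (ρ z)‖ₑ := by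
        rw [lintegral_indicator hS, lintegral_const_mul' _ _ ENNReal.ofReal_ne_top]
      _ ≤ ENNReal.ofReal (2 * c * T) * ((ENNReal.ofReal (2 / (n + 1 : ℝ)))⁻¹ *
          ∫⁻ z in S, ‖f z - f (ρ z)‖ₑ) := by
        rw [← mul_assoc, ← ENNReal.ofReal_inv_of_pos (by positivity),
          ← ENNReal.ofReal_mul (by positivity)]
        refine mul_le_mul_left (ENNReal.ofReal_le_ofReal (le_of_eq ?_)) _
        field_simp
  have hD : Tendsto (fun n => ∫⁻ z, D n z) atTop (𝓝 0) := by
    set K := tsupport θ ∪ ρ ⁻¹' tsupport θ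
    have hKm : MeasurableSet K := (isClosed_tsupport θ).measurableSet.union
      ((isClosed_tsupport θ).preimage hρc).measurableSet
    have hKv : volume K ≠ ⊤ := by
      refine ((measure_union_le _ _).trans_lt (ENNReal.add_lt_top.2 ⟨hθc.measure_lt_top, ?_⟩)).ne
      rw [hρm.measure_preimage (isClosed_tsupport θ).measurableSet.nullMeasurableSet]
      exact hθc.measure_lt_top
    have := tendsto_lintegral_of_dominated_convergence (μ := volume) (F := D) (f := fun _ => 0)
      (K.indicator fun _ => ENNReal.ofReal (c * (L * 4) * B)) hDm (fun n => ae_of_all _ fun z => ?_)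
      (by
        rw [lintegral_indicator hKm]
        simp only [lintegral_const, Measure.restrict_apply MeasurableSet.univ, univ_inter]
        exact ENNReal.mul_ne_top ENNReal.ofReal_ne_top hKv) ?_
    · simpa using this
    · by_cases hz : z ∈ K
      · rw [indicator_of_mem hz]
        simp only [D]
        rw [← ofReal_norm]
        refine ENNReal.ofReal_le_ofReal ?_
        rw [norm_mul, Real.norm_of_nonneg hB0]
        gcongr
        by_cases h2 : 2 / (n + 1 : ℝ) ≤ |z.2 - k z.1|
        · rw [hA0 n z h2]; simp; positivity
        · rw [norm_mul]
          have hn : (0 : ℝ) < n + 1 := by positivity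
          calc ‖A n z‖ * ‖θ z - θ (ρ z)‖ ≤ (c * (n + 1 : ℝ)) * (L * (2 * (2 / (n + 1 : ℝ)))) := by
                refine mul_le_mul (hAle n z) ((hθρ z).trans ?_) (norm_nonneg _) (by positivity)
                gcongr
                exact (not_le.1 h2).le
            _ = c * (L * 4) := by field_simp; ring
      · rw [indicator_of_notMem hz]
        have h1 : θ z = 0 := image_eq_zero_of_notMem_tsupport fun h => hz (Or.inl h)
        have h2 : θ (ρ z) = 0 := image_eq_zero_of_notMem_tsupport fun h => hz (Or.inr h)
        simp [D, h1, h2]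
    · have hnull : ∀ᵐ z : E × ℝ, z.2 ≠ k z.1 := by
        rw [ae_iff]
        simp only [not_not]
        exact measure_graph volume hkc.measurable
      filter_upwards [hnull] with z hz
      refine tendsto_const_nhds.congr' ?_
      have h0 : 0 < |z.2 - k z.1| := abs_pos.2 (sub_ne_zero.2 hz)
      obtain ⟨m, hm⟩ := exists_nat_gt (2 / |z.2 - k z.1|)
      filter_upwards [eventually_ge_atTop m] with n hn
      have : A n z = 0 := by
        refine hA0 n z ?_
        rw [div_le_iff₀ (by positivity), ← div_le_iff₀' h0]
        have : (m : ℝ) ≤ n := by exact_mod_cast hn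
        linarith
      simp [D, this]
  have hlim : Tendsto (fun n => ∫⁻ z, W n z + D n z) atTop (𝓝 0) := by
    have := hW.add hD
    simp only [add_zero] at this
    refine this.congr fun n => ?_
    rw [lintegral_add_right _ (hDm n)]
  have h2J : Tendsto (fun n => (2 : ℝ) • J n) atTop (𝓝 0) := by
    rw [tendsto_zero_iff_enorm_tendsto_zero]
    refine tendsto_of_tendsto_of_tendsto_of_le_of_le tendsto_const_nhds hlim (fun _ => zero_le)
      fun n => ?_
    simp only
    rw [hJ]
    exact (enorm_integral_le_lintegral_enorm _).trans (lintegral_mono (hpt n))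
  have := h2J.const_smul (2⁻¹ : ℝ)
  simpa [smul_smul] using this

end WeakDeriv

section WeakDeriv

variable {E F : Type*} [NormedAddCommGroup E] [InnerProductSpace ℝ E] [FiniteDimensional ℝ E]
  [MeasurableSpace E] [BorelSpace E] [NormedAddCommGroup F]

/-- Local integrability extends across the graph of a continuous function, if the integrals
over compact sets are finite. -/
lemma locallyIntegrableOn_of_off_graph {O : Set (E × ℝ)} (hO : IsOpen O) {f : E × ℝ → F}
    {k : E → ℝ} (hk : Continuous k)
    (h : LocallyIntegrableOn f (O ∩ {z | z.2 ≠ k z.1}))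
    (hfin : ∀ K ⊆ O, IsCompact K → ∫⁻ z in K, ‖f z‖ₑ < ⊤) : LocallyIntegrableOn f O := by
  rw [locallyIntegrableOn_iff hO.isLocallyClosed]
  intro K hK hKc
  refine ⟨?_, hfin K hK hKc⟩
  have hae : (O ∩ {z : E × ℝ | z.2 ≠ k z.1} : Set (E × ℝ)) =ᵐ[volume] O := by
    have hnull : ∀ᵐ z : E × ℝ, z.2 ≠ k z.1 := by
      rw [ae_iff]
      simp only [not_not]
      exact measure_graph volume hk.measurable
    filter_upwards [hnull] with z hz
    exact propext ⟨fun h => h.1, fun h => ⟨h, hz⟩⟩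
  have := h.aestronglyMeasurable
  rw [Measure.restrict_congr_set hae] at this
  exact this.mono_measure (Measure.restrict_mono hK le_rfl)

variable [NormedSpace ℝ F]

/-- **Gluing along a graph.** If `f` is bounded and weakly differentiable off the graph of `k`, with
a derivative that is integrable on compact sets, and if `f` has the same trace on the graph from
both sides, then `f` is weakly differentiable across the graph. The traces are compared through the
reflection `(y, t) ↦ (y, 2 k y - t)`. -/
lemma IsWeakDeriv.glue {O : Set (E × ℝ)} (hO : IsOpen O) {f : E × ℝ → F}
    {g : E × ℝ → E × ℝ →ₗ[ℝ] F} {k : E → ℝ} (hk : ContDiff ℝ ∞ k)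
    (h : IsWeakDeriv (O ∩ {z | z.2 ≠ k z.1}) f g) {B : ℝ} (hB : ∀ z, ‖f z‖ ≤ B)
    (hg : ∀ K ⊆ O, IsCompact K → ∀ v, ∫⁻ z in K, ‖g z v‖ₑ < ⊤)
    (htr : ∀ K ⊆ O, IsCompact K → Tendsto (fun δ : ℝ => (ENNReal.ofReal δ)⁻¹ *
      ∫⁻ z in K ∩ {z | |z.2 - k z.1| < δ}, ‖f z - f (shear (-1) (fun y => 2 * k y) z)‖ₑ)
      (𝓝[>] 0) (𝓝 0)) :
    IsWeakDeriv O f g := by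
  have hkc := hk.continuous
  have hf : LocallyIntegrableOn f O := by
    refine locallyIntegrableOn_of_off_graph hO hkc h.locallyIntegrableOn fun K hK hKc => ?_
    calc ∫⁻ z in K, ‖f z‖ₑ ≤ ∫⁻ _ in K, ENNReal.ofReal B := by
          refine lintegral_mono fun z => ?_
          rw [← ofReal_norm]
          exact ENNReal.ofReal_le_ofReal (hB z)
      _ < ⊤ := by
          rw [lintegral_const, Measure.restrict_apply MeasurableSet.univ, univ_inter]
          exact ENNReal.mul_lt_top ENNReal.ofReal_lt_top hKc.measure_lt_top
  have hgl : ∀ v, LocallyIntegrableOn (fun z => g z v) O := fun v =>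
    locallyIntegrableOn_of_off_graph hO hkc (h.locallyIntegrableOn_deriv v)
      fun K hK hKc => hg K hK hKc v
  refine ⟨hf, hgl, fun v ψ hψ hψc hψs => ?_⟩
  set m : E × ℝ → ℝ := fun z => z.2 - k z.1
  have hm : ContDiff ℝ ∞ m := by fun_prop
  set χ : ℕ → E × ℝ → ℝ := fun n z => cutoff ((n + 1 : ℝ) * m z)
  have hχ : ∀ n, ContDiff ℝ ∞ (χ n) := fun n => contDiff_cutoff.comp (contDiff_const.mul hm)
  set θ : E × ℝ → ℝ := fun z => ψ z * fderiv ℝ m z v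
  have hθ : ContDiff ℝ ∞ θ :=
    hψ.mul ((hm.fderiv_right (m := ∞) (by simp)).clm_apply contDiff_const)
  have hθc : HasCompactSupport θ := hψc.mul_right
  have hθs : tsupport θ ⊆ O := tsupport_mul_subset_left.trans hψs
  set A : ℕ → E × ℝ → ℝ := fun n z => deriv cutoff ((n + 1 : ℝ) * m z) * (n + 1 : ℝ)
  have hAc : ∀ n, Continuous (A n) := fun n =>
    (continuous_deriv_cutoff.comp (continuous_const.mul hm.continuous)).mul continuous_const
  have hDφ : ∀ n z, fderiv ℝ (fun z => χ n z * ψ z) z v =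
      χ n z * fderiv ℝ ψ z v + A n z * θ z := fun n z => by
    have hm' := ((hm.differentiable (by simp)) z).hasFDerivAt
    have h1 : HasFDerivAt (χ n) (deriv cutoff ((n + 1 : ℝ) * m z) • ((n + 1 : ℝ) • fderiv ℝ m z))
        z := ((contDiff_cutoff.differentiable (by simp)) _).hasDerivAt.comp_hasFDerivAt z
          (hm'.const_mul (n + 1 : ℝ))
    have h2 : fderiv ℝ (fun z => χ n z * ψ z) z = _ :=
      (h1.mul ((hψ.differentiable (by simp)) z).hasFDerivAt).fderiv
    rw [h2]
    simp [A, θ]; ring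
  have hφs : ∀ n, tsupport (fun z => χ n z * ψ z) ⊆ O ∩ {z | z.2 ≠ k z.1} := fun n => by
    refine subset_inter (tsupport_mul_subset_right.trans hψs) fun z hz hz' => ?_
    have hcl : tsupport (χ n) ⊆ {z | 1 ≤ |(n + 1 : ℝ) * m z|} := by
      refine closure_minimal (fun z hz => ?_) (isClosed_le continuous_const
        (continuous_const.mul hm.continuous).abs)
      by_contra h'
      exact hz (cutoff_eq_zero (not_le.1 h').le)
    have := hcl (tsupport_mul_subset_left hz)
    simp only [mem_ofPred_eq, m, hz', sub_self, mul_zero, abs_zero] at this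
    linarith
  have i₁ : Integrable (fun z => (fderiv ℝ ψ z v) • f z) :=
    integrable_fderiv_smul hf hψ hψc hψs v
  have i₂ : Integrable (fun z => ψ z • g z v) :=
    integrable_smul_of_tsupport_subset (hgl v) hψ.continuous hψc hψs
  have iθ : ∀ α : E × ℝ → ℝ, Continuous α → Integrable fun z => (α z * θ z) • f z :=
    fun α hα => integrable_smul_of_tsupport_subset hf (hα.mul hθ.continuous) hθc.mul_left
      (tsupport_mul_subset_right.trans hθs)
  -- multiplication by the cutoffs converges by dominated convergence
  have hcut : ∀ w : E × ℝ → F, Integrable w →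
      (∀ n, Integrable fun z => χ n z • w z) ∧
      Tendsto (fun n => ∫ z, χ n z • w z) atTop (𝓝 (∫ z, w z)) := fun w hw => by
    have hmeas : ∀ n, AEStronglyMeasurable (fun z => χ n z • w z) volume := fun n =>
      (hχ n).continuous.aestronglyMeasurable.smul hw.aestronglyMeasurable
    have hle : ∀ n, ∀ᵐ z, ‖χ n z • w z‖ ≤ ‖w z‖ := fun n => ae_of_all _ fun z => by
      rw [norm_smul]
      exact mul_le_of_le_one_left (norm_nonneg _) (abs_cutoff_le _)
    refine ⟨fun n => hw.mono (hmeas n) (hle n),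
      tendsto_integral_of_dominated_convergence _ hmeas hw.norm hle ?_⟩
    have hnull : ∀ᵐ z : E × ℝ, z.2 ≠ k z.1 := by
      rw [ae_iff]
      simp only [not_not]
      exact measure_graph volume hkc.measurable
    filter_upwards [hnull] with z hz
    refine tendsto_const_nhds.congr' ?_
    have h0 : 0 < |m z| := abs_pos.2 (sub_ne_zero.2 hz)
    obtain ⟨N, hN⟩ := exists_nat_gt ((3 / 2) / |m z|)
    filter_upwards [eventually_ge_atTop N] with n hn
    have : χ n z = 1 := by
      refine cutoff_eq_one ?_
      rw [abs_mul, abs_of_pos (by positivity), ← div_le_iff₀ h0]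
      have : (N : ℝ) ≤ n := by exact_mod_cast hn
      linarith
    rw [this, one_smul]
  have hid : ∀ n, (∫ z, χ n z • ((fderiv ℝ ψ z v) • f z)) + ∫ z, (A n z * θ z) • f z =
      - ∫ z, χ n z • (ψ z • g z v) := fun n => by
    have := h.integral_eq v (fun z => χ n z * ψ z) ((hχ n).mul hψ) hψc.mul_left (hφs n)
    simp_rw [hDφ, add_smul, mul_smul (χ n _)] at this
    rw [← this, integral_add ((hcut _ i₁).1 n) (iθ _ (hAc n))]
  have hA := tendsto_integral_deriv_cutoff hB hk hθ hθc iθ (htr _ hθs hθc)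
  have hl := (hcut _ i₁).2.add hA
  have hr := (hcut _ i₂).2.neg
  rw [add_zero] at hl
  refine tendsto_nhds_unique hl (hr.congr fun n => ?_)
  exact (hid n).symm

end WeakDeriv

/-! ### Folding two maps along a function -/

/-- The map `V` on `X × (0, ∞)` that is made of the maps `f₁` and `f₂` on `X × (0, ∞)`: at the
height `t` over `x`, it takes the value of `f₂` at the distance of `t` from `{0, k x}` if
`t ≤ k x`, and the value of `f₁` at the height `t - k x` if `t > k x`. It is continuous if `f₁` and
`f₂` are and have the same limit at `t = 0`, and then it has this limit at `t = 0` too. -/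
noncomputable def fold {X Y : Type*} (k : X → ℝ) (f₁ f₂ : X × ℝ → Y) (q : X × ℝ) : Y :=
  if k q.1 < q.2 then f₁ (q.1, q.2 - k q.1) else
    if k q.1 / 2 < q.2 then f₂ (q.1, k q.1 - q.2) else f₂ q

section WeakDeriv

variable {E F : Type*} [NormedAddCommGroup E] [InnerProductSpace ℝ E] [FiniteDimensional ℝ E]
  [MeasurableSpace E] [BorelSpace E] [NormedAddCommGroup F] [NormedSpace ℝ F]

/-- A fold of weakly differentiable maps with the same trace is weakly differentiable: off the
graphs of `k / 2` and `k` by the chain rule, and across these graphs by gluing. At the graph of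
`k / 2` the fold is symmetric, and at the graph of `k` the traces from both sides are those of `f₁`
and `f₂` at `t = 0`. -/
lemma IsWeakDeriv.fold {N N₁ N₂ : Set E} (hN : IsOpen N) (hN₁ : IsOpen N₁) (hN₂ : IsOpen N₂)
    {k : E → ℝ} (hk : ContDiff ℝ ∞ k) {f f₁ f₂ : E × ℝ → F} {g g₁ g₂ : E × ℝ → E × ℝ →ₗ[ℝ] F}
    (h₁ : IsWeakDeriv (N₁ ×ˢ Ioo 0 1) f₁ g₁) (h₂ : IsWeakDeriv (N₂ ×ˢ Ioo 0 1) f₂ g₂)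
    (hk0 : ∀ y ∈ N, 0 ≤ k y) (hk₁ : ∀ y ∈ N, k y < 2 → y ∈ N₁) (hk₂ : ∀ y ∈ N, 0 < k y → y ∈ N₂)
    (hf : ∀ z ∈ N ×ˢ Ioo (0 : ℝ) 1, f z = Collar.fold k f₁ f₂ z)
    (hg₁ : ∀ y ∈ N, ∀ t : ℝ, k y < t → ∀ v,
      g (y, t) v = g₁ (y, t - k y) (v.1, v.2 - fderiv ℝ k y v.1))
    (hg₂ : ∀ y ∈ N, ∀ t : ℝ, k y / 2 < t → t < k y → ∀ v,
      g (y, t) v = g₂ (y, k y - t) (v.1, fderiv ℝ k y v.1 - v.2))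
    (hg₃ : ∀ y ∈ N, ∀ t : ℝ, t < k y / 2 → 0 < t → ∀ v, g (y, t) v = g₂ (y, t) v)
    {B : ℝ} (hB : ∀ z, ‖f z‖ ≤ B)
    (hfin : ∀ K ⊆ N ×ˢ Ioo (0 : ℝ) 1, IsCompact K → ∀ v, ∫⁻ z in K, ‖g z v‖ₑ < ⊤)
    (htr : ∀ K ⊆ N₁ ∩ N₂, IsCompact K → Tendsto (fun δ : ℝ => (ENNReal.ofReal δ)⁻¹ *
      ∫⁻ z in K ×ˢ Ioo 0 δ, ‖f₁ z - f₂ z‖ₑ) (𝓝[>] 0) (𝓝 0)) :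
    IsWeakDeriv (N ×ˢ Ioo 0 1) f g := by
  have hkc := hk.continuous
  have hkf : Continuous fun z : E × ℝ => k z.1 := hkc.comp continuous_fst
  set Q : Set (E × ℝ) := N ×ˢ Ioo (0 : ℝ) 1
  have hQ : IsOpen Q := hN.prod isOpen_Ioo
  have hf₁ : ∀ y t, (y, t) ∈ Q → k y < t → f (y, t) = f₁ (y, t - k y) := fun y t hz h => by
    rw [hf _ hz, Collar.fold, if_pos h]
  have hf₂ : ∀ y t, (y, t) ∈ Q → k y / 2 < t → t < k y → f (y, t) = f₂ (y, k y - t) :=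
    fun y t hz h h' => by rw [hf _ hz, Collar.fold, if_neg (not_lt.2 h'.le), if_pos h]
  have hf₃ : ∀ y t, (y, t) ∈ Q → t ≤ k y / 2 → f (y, t) = f₂ (y, t) := fun y t hz h => by
    have : 0 < t := hz.2.1
    have h' : ¬ k y < t := by linarith
    rw [hf _ hz, Collar.fold, if_neg h', if_neg (not_lt.2 h)]
  have O₁ : IsWeakDeriv (Q ∩ {z | k z.1 < z.2}) f g := by
    have ho : IsOpen (Q ∩ {z : E × ℝ | k z.1 < z.2}) := hQ.inter (isOpen_lt hkf continuous_snd)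
    refine IsWeakDeriv.congr ho (IsWeakDeriv.mono
      (h₁.comp_shear (hN₁.prod isOpen_Ioo) (σ := 1) (by norm_num) hk.neg) ?_) ?_ ?_
    · rintro ⟨y, t⟩ ⟨⟨hy, ht⟩, hkt⟩
      simp only [mem_ofPred_eq] at hkt
      have := hk0 y hy
      simp only [mem_preimage, shear, mem_prod, mem_Ioo]
      refine ⟨hk₁ y hy (by linarith [ht.2]), ?_, ?_⟩ <;> linarith [ht.1, ht.2]
    · rintro ⟨y, t⟩ ⟨hz, hkt⟩
      rw [hf₁ y t hz hkt]
      simp [shear, sub_eq_add_neg]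
    · rintro ⟨y, t⟩ ⟨hz, hkt⟩ v
      rw [hg₁ y hz.1 t hkt]
      simp [shear, shearLin_apply, sub_eq_add_neg]
  have O₂ : IsWeakDeriv (Q ∩ {z | k z.1 / 2 < z.2 ∧ z.2 < k z.1}) f g := by
    have ho : IsOpen (Q ∩ {z : E × ℝ | k z.1 / 2 < z.2 ∧ z.2 < k z.1}) :=
      hQ.inter ((isOpen_lt (hkf.div_const 2) continuous_snd).inter (isOpen_lt continuous_snd hkf))
    refine IsWeakDeriv.congr ho (IsWeakDeriv.mono
      (h₂.comp_shear (hN₂.prod isOpen_Ioo) (σ := -1) (by norm_num) hk) ?_) ?_ ?_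
    · rintro ⟨y, t⟩ ⟨⟨hy, ht⟩, hkt⟩
      simp only [mem_ofPred_eq] at hkt
      simp only [mem_preimage, shear, mem_prod, mem_Ioo]
      refine ⟨hk₂ y hy (by linarith [ht.1, hkt.2]), ?_, ?_⟩ <;> linarith [ht.1, ht.2, hkt.1, hkt.2]
    · rintro ⟨y, t⟩ ⟨hz, hkt⟩
      rw [hf₂ y t hz hkt.1 hkt.2]
      simp [shear, sub_eq_neg_add]
    · rintro ⟨y, t⟩ ⟨hz, hkt⟩ v
      rw [hg₂ y hz.1 t hkt.1 hkt.2]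
      simp [shear, shearLin_apply, sub_eq_neg_add]
  have O₃ : IsWeakDeriv (Q ∩ {z | z.2 < k z.1 / 2}) f g := by
    have ho : IsOpen (Q ∩ {z : E × ℝ | z.2 < k z.1 / 2}) :=
      hQ.inter (isOpen_lt continuous_snd (hkf.div_const 2))
    refine IsWeakDeriv.congr ho (h₂.mono ?_) ?_ ?_
    · rintro ⟨y, t⟩ ⟨⟨hy, ht⟩, hkt⟩
      simp only [mem_ofPred_eq] at hkt
      exact ⟨hk₂ y hy (by linarith [ht.1]), ht⟩
    · rintro ⟨y, t⟩ ⟨hz, hkt⟩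
      exact hf₃ y t hz (le_of_lt hkt)
    · rintro ⟨y, t⟩ ⟨hz, hkt⟩ v
      exact hg₃ y hz.1 t hkt hz.2.1 v
  -- a neighbourhood of the graph of `k` in `Q` that the reflection in this graph maps to `Q`
  have o₄ : IsOpen
      (Q ∩ {z : E × ℝ | k z.1 / 2 < z.2 ∧ z.2 < 3 * k z.1 / 2 ∧ 2 * k z.1 - z.2 < 1}) :=
    hQ.inter ((isOpen_lt (f := fun z : E × ℝ => k z.1 / 2) (by fun_prop) continuous_snd).and
      ((isOpen_lt (g := fun z : E × ℝ => 3 * k z.1 / 2) continuous_snd (by fun_prop)).and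
        (isOpen_lt (f := fun z : E × ℝ => 2 * k z.1 - z.2) (by fun_prop) continuous_const)))
  have O₄ : IsWeakDeriv
      (Q ∩ {z | k z.1 / 2 < z.2 ∧ z.2 < 3 * k z.1 / 2 ∧ 2 * k z.1 - z.2 < 1}) f g := by
    refine IsWeakDeriv.glue o₄ hk (IsWeakDeriv.of_local ?_) hB
      (fun K hK hKc v => hfin K (hK.trans inter_subset_left) hKc v) ?_
    · rintro ⟨y, t⟩ ⟨⟨hz, hkt⟩, hne⟩
      rcases lt_or_gt_of_ne hne with h | h
      · exact ⟨_, hQ.inter ((isOpen_lt (hkf.div_const 2) continuous_snd).inter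
          (isOpen_lt continuous_snd hkf)), ⟨hz, hkt.1, h⟩, O₂⟩
      · exact ⟨_, hQ.inter (isOpen_lt hkf continuous_snd), ⟨hz, h⟩, O₁⟩
    · intro K hK hKc
      have hK' : Prod.fst '' K ⊆ N₁ ∩ N₂ := by
        rintro _ ⟨⟨y, t⟩, hz, rfl⟩
        obtain ⟨⟨hy, ht⟩, h1, h2, h3⟩ := hK hz
        simp only at h1 h2 h3 hy ht
        exact ⟨hk₁ y hy (by linarith [ht.2]), hk₂ y hy (by linarith [ht.1])⟩
      have hlim := ENNReal.Tendsto.const_mul (a := 3)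
        (htr _ hK' (hKc.image continuous_fst)) (Or.inr (by simp))
      rw [mul_zero] at hlim
      refine tendsto_of_tendsto_of_tendsto_of_le_of_le tendsto_const_nhds hlim (fun _ => zero_le)
        fun δ => ?_
      have hS : MeasurableSet (K ∩ {z : E × ℝ | |z.2 - k z.1| < δ}) :=
        hKc.isClosed.measurableSet.inter
          (isOpen_lt (by fun_prop) continuous_const).measurableSet
      have key := setLIntegral_fold_le (volume : Measure E) hkc.measurable (S := K ∩
        {z : E × ℝ | |z.2 - k z.1| < δ}) (T₁ := (Prod.fst '' K) ×ˢ Ioo 0 δ)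
        (T₂ := (Prod.fst '' K) ×ˢ Ioo 0 δ)
        (f := fun z => ‖f z - f (shear (-1) (fun y => 2 * k y) z)‖ₑ)
        (f₁ := fun z => ‖f₁ z - f₂ z‖ₑ) (f₂ := fun z => ‖f₁ z - f₂ z‖ₑ) hS ?_ ?_ ?_
      · calc _ ≤ (ENNReal.ofReal δ)⁻¹ * _ := mul_le_mul_right key _
          _ = _ := by
            simp only [Measure.volume_eq_prod]
            ring
      all_goals
        intro y t hyt
        obtain ⟨hzK, hδ⟩ := hyt
        obtain ⟨⟨hy, ht⟩, h1, h2, h3⟩ := hK hzK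
        simp only [mem_ofPred_eq] at h1 h2 h3 hy ht hδ
        have hρ : shear (-1) (fun y => 2 * k y) (y, t) = (y, 2 * k y - t) := by
          simp [shear, sub_eq_neg_add]
        have hρQ : (y, 2 * k y - t) ∈ Q := ⟨hy, by simp only; linarith, by simp only; linarith⟩
        have hzQ : (y, t) ∈ Q := ⟨hy, ht⟩
      · intro hkt
        refine ⟨⟨⟨_, hzK, rfl⟩, by simp only; linarith, lt_of_abs_lt hδ⟩, le_of_eq ?_⟩
        rw [hρ, hf₁ y t hzQ hkt, hf₂ y _ hρQ (by linarith) (by linarith)]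
        congr 4
        ring
      · intro _ hkt
        refine ⟨⟨⟨_, hzK, rfl⟩, by simp only; linarith, ?_⟩, le_of_eq ?_⟩
        · simp only; linarith [neg_lt_of_abs_lt hδ]
        · rw [hρ, hf₂ y t hzQ h1 hkt, hf₁ y _ hρQ (by linarith), ← enorm_neg, neg_sub]
          congr 4
          ring
      · intro hkt
        linarith
  -- the same for the graph of `k / 2`
  have o₅ : IsOpen (Q ∩ {z : E × ℝ | z.2 < k z.1 ∧ k z.1 - z.2 < 1}) :=
    hQ.inter ((isOpen_lt continuous_snd hkf).and
      (isOpen_lt (f := fun z : E × ℝ => k z.1 - z.2) (by fun_prop) continuous_const))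
  have O₅ : IsWeakDeriv (Q ∩ {z | z.2 < k z.1 ∧ k z.1 - z.2 < 1}) f g := by
    refine IsWeakDeriv.glue o₅ (k := fun y => k y / 2) (hk.div_const 2)
      (IsWeakDeriv.of_local ?_) hB
      (fun K hK hKc v => hfin K (hK.trans inter_subset_left) hKc v) ?_
    · rintro ⟨y, t⟩ ⟨⟨hz, hkt⟩, hne⟩
      rcases lt_or_gt_of_ne hne with h | h
      · exact ⟨_, hQ.inter (isOpen_lt continuous_snd (hkf.div_const 2)), ⟨hz, h⟩, O₃⟩
      · exact ⟨_, hQ.inter ((isOpen_lt (hkf.div_const 2) continuous_snd).inter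
          (isOpen_lt continuous_snd hkf)), ⟨hz, h, hkt.1⟩, O₂⟩
    · intro K hK hKc
      refine tendsto_const_nhds.congr fun δ => ?_
      have hS : MeasurableSet (K ∩ {z : E × ℝ | |z.2 - k z.1 / 2| < δ}) :=
        hKc.isClosed.measurableSet.inter
          (isOpen_lt (by fun_prop) continuous_const).measurableSet
      rw [setLIntegral_congr_fun (g := fun _ => 0) hS, lintegral_zero, mul_zero]
      rintro ⟨y, t⟩ ⟨hzK, -⟩
      obtain ⟨⟨hy, ht⟩, h1, h2⟩ := hK hzK
      simp only at h1 h2 hy ht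
      have hρ : shear (-1) (fun y => 2 * (k y / 2)) (y, t) = (y, k y - t) := by
        simp only [shear, Prod.mk.injEq, true_and]; ring
      have hρQ : (y, k y - t) ∈ Q := ⟨hy, by simp only; linarith, h2⟩
      have hzQ : (y, t) ∈ Q := ⟨hy, ht⟩
      simp only [hρ]
      rcases lt_trichotomy t (k y / 2) with h | h | h
      · rw [hf₃ y t hzQ h.le, hf₂ y _ hρQ (by linarith) (by linarith [ht.1]), sub_sub_cancel]
        simp
      · rw [show k y - t = t by linarith]
        simp
      · rw [hf₂ y t hzQ h h1, hf₃ y _ hρQ (by linarith)]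
        simp
  refine IsWeakDeriv.of_local ?_
  rintro ⟨y, t⟩ hz
  have hy : y ∈ N := hz.1
  have ht : t ∈ Ioo (0 : ℝ) 1 := hz.2
  rcases lt_trichotomy t (k y) with h | h | h
  · by_cases h' : k y - t < 1
    · exact ⟨_, o₅, ⟨hz, h, h'⟩, O₅⟩
    · refine ⟨_, hQ.inter (isOpen_lt continuous_snd (hkf.div_const 2)), ⟨hz, ?_⟩, O₃⟩
      simp only [mem_ofPred_eq]
      linarith [ht.2]
  · refine ⟨_, o₄, ⟨hz, ?_⟩, O₄⟩
    simp only [mem_ofPred_eq]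
    refine ⟨?_, ?_, ?_⟩ <;> linarith [ht.1, ht.2]
  · exact ⟨_, hQ.inter (isOpen_lt hkf continuous_snd), ⟨hz, h⟩, O₁⟩

end WeakDeriv

/-! ### The Riemannian metric in charts -/

section Riemannian

variable {d : ℕ} {M : Type*} [TopologicalSpace M] [ChartedSpace (EuclideanSpace ℝ (Fin d)) M]
  {e : OpenPartialHomeomorph M (EuclideanSpace ℝ (Fin d))}

lemma mdifferentiable_of_mem_maximalAtlas (he : e ∈ IsManifold.maximalAtlas (𝓡 d) ∞ M) :
    e.MDifferentiable (𝓡 d) (𝓡 d) :=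
  ⟨(contMDiffOn_of_mem_maximalAtlas he).mdifferentiableOn (by simp),
    (contMDiffOn_symm_of_mem_maximalAtlas he).mdifferentiableOn (by simp)⟩

/-- The derivative of the inverse of the chart `e` at the point with coordinates `y`. -/
noncomputable def chartDeriv (e : OpenPartialHomeomorph M (EuclideanSpace ℝ (Fin d)))
    (y : EuclideanSpace ℝ (Fin d)) :
    EuclideanSpace ℝ (Fin d) →L[ℝ] TangentSpace (𝓡 d) (e.symm y) :=
  mfderiv (𝓡 d) (𝓡 d) e.symm y

lemma injective_chartDeriv (he : e ∈ IsManifold.maximalAtlas (𝓡 d) ∞ M)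
    {y : EuclideanSpace ℝ (Fin d)} (hy : y ∈ e.target) :
    Function.Injective (chartDeriv e y) :=
  (mdifferentiable_of_mem_maximalAtlas he).symm.mfderiv_injective hy

variable [IsManifold (𝓡 d) ∞ M]

/-- The derivative of the inverse of a chart, as a continuous map into the tangent bundle. -/
lemma continuousOn_chartDeriv (he : e ∈ IsManifold.maximalAtlas (𝓡 d) ∞ M) :
    ContinuousOn (fun z : EuclideanSpace ℝ (Fin d) × EuclideanSpace ℝ (Fin d) =>
      (⟨e.symm z.1, chartDeriv e z.1 z.2⟩ :
        TotalSpace (EuclideanSpace ℝ (Fin d)) (fun x : M => TangentSpace (𝓡 d) x)))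
      (e.target ×ˢ univ) := by
  have h := (contMDiffOn_symm_of_mem_maximalAtlas he).continuousOn_tangentMapWithin (by simp)
    e.open_target.uniqueMDiffOn
  have h' : Continuous fun z : EuclideanSpace ℝ (Fin d) × EuclideanSpace ℝ (Fin d) =>
      ((tangentBundleModelSpaceHomeomorph (𝓡 d)).symm z : TangentBundle (𝓡 d)
        (EuclideanSpace ℝ (Fin d))) :=
    (tangentBundleModelSpaceHomeomorph (𝓡 d)).symm.continuous
  refine (h.comp h'.continuousOn fun z hz => hz.1).congr fun z hz => ?_
  simp only [Function.comp_apply, tangentMapWithin]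
  rw [mfderivWithin_of_isOpen e.open_target]
  · rfl
  · exact hz.1

variable [RiemannianBundle (fun x : M => TangentSpace (𝓡 d) x)]
  [IsContMDiffRiemannianBundle (𝓡 d) ∞ (EuclideanSpace ℝ (Fin d))
    (fun x : M => TangentSpace (𝓡 d) x)]

/-- A smooth Riemannian metric is continuous. -/
instance isContinuousRiemannianBundle_tangentSpace :
    IsContinuousRiemannianBundle (EuclideanSpace ℝ (Fin d))
      (fun x : M => TangentSpace (𝓡 d) x) := by
  obtain ⟨g, hg, hg'⟩ := IsContMDiffRiemannianBundle.exists_contMDiff (IB := 𝓡 d) (n := ∞)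
    (F := EuclideanSpace ℝ (Fin d)) (E := fun x : M => TangentSpace (𝓡 d) x)
  exact ⟨g, hg.continuous, hg'⟩

lemma continuousOn_inner_chartDeriv (he : e ∈ IsManifold.maximalAtlas (𝓡 d) ∞ M) :
    ContinuousOn (fun z : EuclideanSpace ℝ (Fin d) × EuclideanSpace ℝ (Fin d) ×
      EuclideanSpace ℝ (Fin d) => inner ℝ (chartDeriv e z.1 z.2.1)
        (chartDeriv e z.1 z.2.2)) (e.target ×ˢ univ) := by
  have h := continuousOn_chartDeriv he
  have h₁ : ContinuousOn (fun z : EuclideanSpace ℝ (Fin d) × EuclideanSpace ℝ (Fin d) ×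
      EuclideanSpace ℝ (Fin d) => (⟨e.symm z.1, chartDeriv e z.1 z.2.1⟩ :
        TotalSpace (EuclideanSpace ℝ (Fin d)) (fun x : M => TangentSpace (𝓡 d) x)))
      (e.target ×ˢ univ) :=
    h.comp (f := fun z : EuclideanSpace ℝ (Fin d) × EuclideanSpace ℝ (Fin d) ×
      EuclideanSpace ℝ (Fin d) => (z.1, z.2.1)) (by fun_prop) fun z hz => ⟨hz.1, mem_univ _⟩
  have h₂ : ContinuousOn (fun z : EuclideanSpace ℝ (Fin d) × EuclideanSpace ℝ (Fin d) ×
      EuclideanSpace ℝ (Fin d) => (⟨e.symm z.1, chartDeriv e z.1 z.2.2⟩ :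
        TotalSpace (EuclideanSpace ℝ (Fin d)) (fun x : M => TangentSpace (𝓡 d) x)))
      (e.target ×ˢ univ) :=
    h.comp (f := fun z : EuclideanSpace ℝ (Fin d) × EuclideanSpace ℝ (Fin d) ×
      EuclideanSpace ℝ (Fin d) => (z.1, z.2.2)) (by fun_prop) fun z hz => ⟨hz.1, mem_univ _⟩
  exact ContinuousOn.inner_bundle (F := EuclideanSpace ℝ (Fin d))
    (E := fun x : M => TangentSpace (𝓡 d) x)
    (b := fun z : EuclideanSpace ℝ (Fin d) × EuclideanSpace ℝ (Fin d) ×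
      EuclideanSpace ℝ (Fin d) => e.symm z.1)
    (v := fun z => chartDeriv e z.1 z.2.1) (w := fun z => chartDeriv e z.1 z.2.2) h₁ h₂

lemma continuousOn_norm_chartDeriv (he : e ∈ IsManifold.maximalAtlas (𝓡 d) ∞ M) :
    ContinuousOn (fun z : EuclideanSpace ℝ (Fin d) × EuclideanSpace ℝ (Fin d) =>
      ‖chartDeriv e z.1 z.2‖) (e.target ×ˢ univ) := by
  have h := ((continuousOn_inner_chartDeriv he).comp
    (f := fun z : EuclideanSpace ℝ (Fin d) × EuclideanSpace ℝ (Fin d) => (z.1, z.2, z.2))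
    (s := e.target ×ˢ univ) (by fun_prop) fun z hz => ⟨hz.1, mem_univ _⟩).sqrt
  refine h.congr fun z _ => ?_
  exact norm_eq_sqrt_real_inner _

/-- On compact subsets of a chart, the norm of the coordinates of a tangent vector is controlled by
its Riemannian norm. -/
lemma exists_norm_le_mul_norm_chartDeriv (he : e ∈ IsManifold.maximalAtlas (𝓡 d) ∞ M)
    {K : Set (EuclideanSpace ℝ (Fin d))} (hK : IsCompact K) (hKe : K ⊆ e.target) :
    ∃ c : ℝ, 0 ≤ c ∧ ∀ y ∈ K, ∀ v : EuclideanSpace ℝ (Fin d),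
      ‖v‖ ≤ c * ‖chartDeriv e y v‖ := by
  set S := K ×ˢ Metric.sphere (0 : EuclideanSpace ℝ (Fin d)) 1
  have hS : IsCompact S := hK.prod (isCompact_sphere _ _)
  have hpos : ∀ z ∈ S, 0 < ‖chartDeriv e z.1 z.2‖ := fun z hz => by
    refine norm_pos_iff.2 fun h0 => ?_
    have : z.2 = 0 := injective_chartDeriv he (hKe hz.1) (h0.trans (map_zero _).symm)
    have h1 := mem_sphere_zero_iff_norm.1 hz.2
    rw [this, norm_zero] at h1
    exact zero_ne_one h1
  obtain ⟨a, ha, haS⟩ : ∃ a : ℝ, 0 < a ∧ ∀ z ∈ S,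
      a ≤ ‖chartDeriv e z.1 z.2‖ :=
    hS.exists_forall_le' ((continuousOn_norm_chartDeriv he).mono
      (prod_mono hKe (subset_univ _))) hpos
  refine ⟨a⁻¹, (inv_pos.2 ha).le, fun y hy v => ?_⟩
  rcases eq_or_ne v 0 with rfl | hv
  · simp only [norm_zero]; positivity
  have hv' : 0 < ‖v‖ := norm_pos_iff.2 hv
  have h1 := haS (y, ‖v‖⁻¹ • v) ⟨hy, by simp [norm_smul, hv'.ne']⟩
  simp only [map_smul, norm_smul, norm_inv, norm_norm] at h1
  rw [inv_mul_eq_div, le_div_iff₀ hv'] at h1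
  rw [inv_mul_eq_div, le_div_iff₀ ha]
  linarith

lemma exists_norm_chartDeriv_le (he : e ∈ IsManifold.maximalAtlas (𝓡 d) ∞ M)
    {K : Set (EuclideanSpace ℝ (Fin d))} (hK : IsCompact K) (hKe : K ⊆ e.target)
    (v : EuclideanSpace ℝ (Fin d)) :
    ∃ c : ℝ, ∀ y ∈ K, ‖chartDeriv e y v‖ ≤ c := by
  have h : ContinuousOn (fun y => ‖chartDeriv e y v‖) K :=
    (continuousOn_norm_chartDeriv he).comp (f := fun y => (y, v)) (by fun_prop)
      fun y hy => ⟨hKe hy, mem_univ _⟩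
  obtain ⟨c, hc⟩ := hK.bddAbove_image h
  exact ⟨c, fun y hy => hc ⟨y, hy, rfl⟩⟩

/-- The Riemannian volume density is bounded below on compact subsets of a chart. -/
lemma exists_pos_le_volumeDensity (he : e ∈ IsManifold.maximalAtlas (𝓡 d) ∞ M)
    {K : Set (EuclideanSpace ℝ (Fin d))} (hK : IsCompact K) (hKe : K ⊆ e.target) :
    ∃ a : ℝ, 0 < a ∧ ∀ y ∈ K, a ≤ volumeDensity e y := by
  refine hK.exists_forall_le' (ContinuousOn.sqrt ?_) fun y hy => Real.sqrt_pos.2 ?_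
  · have : ContinuousOn (fun y => Matrix.gram ℝ (coordVec e y)) K := by
      refine continuousOn_pi.2 fun i => continuousOn_pi.2 fun j => ?_
      exact (continuousOn_inner_chartDeriv he).comp
        (f := fun y => (y, EuclideanSpace.single i (1 : ℝ), EuclideanSpace.single j (1 : ℝ)))
        (by fun_prop) fun y hy => ⟨hKe hy, mem_univ _⟩
    exact (continuous_id.matrix_det).comp_continuousOn this
  · refine (Matrix.posDef_gram_of_linearIndependent ?_).det_pos
    have h := (EuclideanSpace.basisFun (Fin d) ℝ).toBasis.linearIndependent.map'
      (chartDeriv e y : EuclideanSpace ℝ (Fin d) →ₗ[ℝ] TangentSpace (𝓡 d) (e.symm y))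
      (LinearMap.ker_eq_bot.2 (injective_chartDeriv he (hKe hy)))
    have h' : coordVec e y = chartDeriv e y ∘ (EuclideanSpace.basisFun (Fin d) ℝ).toBasis := by
      ext1 j
      simp only [Function.comp_apply, OrthonormalBasis.coe_toBasis, EuclideanSpace.basisFun_apply]
      rfl
    rw [h']
    exact h

end Riemannian

/-! ### Derivatives on the collar and differentials of functions -/

section DerivNorm

variable {d : ℕ} {M : Type*} [TopologicalSpace M] [ChartedSpace (EuclideanSpace ℝ (Fin d)) M]

lemma finrank_tangentSpace (x : M) : Module.finrank ℝ (TangentSpace (𝓡 d) x) = d :=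
  (finrank_euclideanSpace_fin (𝕜 := ℝ) (n := d) :)

variable [RiemannianBundle (fun x : M => TangentSpace (𝓡 d) x)]
  {F : Type*} [NormedAddCommGroup F] [InnerProductSpace ℝ F]

variable {x : M} (L : TangentSpace (𝓡 d) x × ℝ →ₗ[ℝ] F)

lemma derivNorm_nonneg : 0 ≤ derivNorm L := Real.sqrt_nonneg _

lemma norm_apply_basis_le (i) :
    ‖L (stdOrthonormalBasis ℝ (TangentSpace (𝓡 d) x) i, 0)‖ ≤ derivNorm L := by
  refine Real.le_sqrt_of_sq_le ?_
  have := Finset.single_le_sum (f := fun i =>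
    ‖L (stdOrthonormalBasis ℝ (TangentSpace (𝓡 d) x) i, 0)‖ ^ 2)
    (fun _ _ => sq_nonneg _) (Finset.mem_univ i)
  linarith [sq_nonneg ‖L (0, 1)‖]

lemma norm_apply_zero_one_le : ‖L (0, 1)‖ ≤ derivNorm L := by
  refine Real.le_sqrt_of_sq_le ?_
  have : 0 ≤ ∑ i, ‖L (stdOrthonormalBasis ℝ (TangentSpace (𝓡 d) x) i, 0)‖ ^ 2 :=
    Finset.sum_nonneg fun _ _ => sq_nonneg _
  linarith

lemma derivNorm_le {a : ℝ} (ha : 0 ≤ a)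
    (h : ∀ i, ‖L (stdOrthonormalBasis ℝ (TangentSpace (𝓡 d) x) i, 0)‖ ≤ a)
    (h' : ‖L (0, 1)‖ ≤ a) : derivNorm L ≤ (d + 1) * a := by
  refine Real.sqrt_le_iff.2 ⟨by positivity, ?_⟩
  have h1 : ∑ i, ‖L (stdOrthonormalBasis ℝ (TangentSpace (𝓡 d) x) i, 0)‖ ^ 2 ≤ d * a ^ 2 := by
    refine (Finset.sum_le_sum (g := fun _ => a ^ 2) fun i _ => by gcongr; exact h i).trans ?_
    simp [finrank_tangentSpace]
  have h2 : ‖L (0, 1)‖ ^ 2 ≤ a ^ 2 := by gcongr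
  have h3 : (d : ℝ) + 1 ≤ (d + 1) ^ 2 := by
    have : (0 : ℝ) ≤ d := Nat.cast_nonneg d
    nlinarith
  calc _ ≤ (d + 1) * a ^ 2 := by linarith
    _ ≤ (d + 1) ^ 2 * a ^ 2 := by gcongr
    _ = _ := by ring

lemma norm_apply_le (w : TangentSpace (𝓡 d) x) (τ : ℝ) :
    ‖L (w, τ)‖ ≤ (d * ‖w‖ + |τ|) * derivNorm L := by
  set b := stdOrthonormalBasis ℝ (TangentSpace (𝓡 d) x)
  have h : L (w, τ) = ∑ i, inner ℝ (b i) w • L (b i, 0) + τ • L (0, 1) := by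
    have e₁ : (w, τ) = LinearMap.inl ℝ (TangentSpace (𝓡 d) x) ℝ w +
        τ • ((0 : TangentSpace (𝓡 d) x), (1 : ℝ)) := by
      simp
    have e₂ : LinearMap.inl ℝ (TangentSpace (𝓡 d) x) ℝ w =
        ∑ i, inner ℝ (b i) w • LinearMap.inl ℝ (TangentSpace (𝓡 d) x) ℝ (b i) := by
      conv_lhs => rw [← b.sum_repr' w]
      rw [map_sum]
      exact Finset.sum_congr rfl fun i _ => map_smul _ _ _
    rw [e₁, e₂, map_add, map_sum, map_smul]
    congr 1
    exact Finset.sum_congr rfl fun i _ => map_smul _ _ _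
  rw [h]
  refine (norm_add_le _ _).trans ?_
  rw [add_mul]
  refine add_le_add ?_ ?_
  · refine (norm_sum_le _ _).trans ?_
    refine (Finset.sum_le_sum (g := fun _ => ‖w‖ * derivNorm L) fun i _ => ?_).trans ?_
    · rw [norm_smul]
      refine mul_le_mul ?_ (norm_apply_basis_le L i) (norm_nonneg _) (norm_nonneg _)
      refine (norm_inner_le_norm _ _).trans ?_
      rw [b.orthonormal.1 i, one_mul]
    · simp [finrank_tangentSpace, mul_assoc]
  · rw [norm_smul, Real.norm_eq_abs]
    gcongr
    exact norm_apply_zero_one_le L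

/-- The effect of a shear on the norm of a derivative. -/
lemma derivNorm_comp_shearLin_le {σ : ℝ} (hσ : |σ| = 1) (ℓ : TangentSpace (𝓡 d) x →ₗ[ℝ] ℝ) {b : ℝ}
    (hb : 0 ≤ b) (hℓ : ∀ w, |ℓ w| ≤ b * ‖w‖) :
    derivNorm (L ∘ₗ shearLin σ ℓ) ≤ (d + 1) * (d + b + 1) * derivNorm L := by
  have hL := derivNorm_nonneg L
  rw [mul_assoc]
  refine derivNorm_le _ (by positivity) (fun i => ?_) ?_
  · rw [LinearMap.comp_apply, shearLin_apply]
    refine (norm_apply_le L _ _).trans (mul_le_mul_of_nonneg_right ?_ hL)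
    have h1 := (stdOrthonormalBasis ℝ (TangentSpace (𝓡 d) x)).orthonormal.1 i
    have h2 := hℓ (stdOrthonormalBasis ℝ (TangentSpace (𝓡 d) x) i)
    rw [h1, mul_one] at h2
    simp only [h1, mul_zero, zero_add, mul_one]
    linarith
  · rw [LinearMap.comp_apply, shearLin_apply]
    refine (norm_apply_le L _ _).trans (mul_le_mul_of_nonneg_right ?_ hL)
    simp only [norm_zero, mul_zero, mul_one, map_zero, add_zero, hσ]
    have : (0 : ℝ) ≤ d := Nat.cast_nonneg d
    linarith

end DerivNorm

section Differential

variable {d : ℕ} {M : Type*} [TopologicalSpace M] [ChartedSpace (EuclideanSpace ℝ (Fin d)) M]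

/-- The differential of a function on a manifold, as a linear form on the tangent space. -/
noncomputable def differential (h : M → ℝ) (x : M) : TangentSpace (𝓡 d) x →ₗ[ℝ] ℝ :=
  (mfderiv (𝓡 d) 𝓘(ℝ, ℝ) h x).toLinearMap

/-- The differential of a smooth function, in the coordinates of a chart. -/
lemma differential_apply_chartDeriv {e : OpenPartialHomeomorph M (EuclideanSpace ℝ (Fin d))}
    (he : e ∈ IsManifold.maximalAtlas (𝓡 d) ∞ M) {h : M → ℝ}
    (hh : ContMDiff (𝓡 d) 𝓘(ℝ, ℝ) ∞ h) {y : EuclideanSpace ℝ (Fin d)} (hy : y ∈ e.target)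
    (v : EuclideanSpace ℝ (Fin d)) :
    differential h (e.symm y) (chartDeriv e y v) = fderiv ℝ (h ∘ e.symm) y v := by
  have := mfderiv_comp y ((hh (e.symm y)).mdifferentiableAt (by simp))
    ((mdifferentiable_of_mem_maximalAtlas he).mdifferentiableAt_symm hy)
  rw [← mfderiv_eq_fderiv, this]
  rfl

lemma contDiffOn_comp_symm {e : OpenPartialHomeomorph M (EuclideanSpace ℝ (Fin d))}
    (he : e ∈ IsManifold.maximalAtlas (𝓡 d) ∞ M) {h : M → ℝ}
    (hh : ContMDiff (𝓡 d) 𝓘(ℝ, ℝ) ∞ h) : ContDiffOn ℝ ∞ (h ∘ e.symm) e.target :=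
  (hh.comp_contMDiffOn (contMDiffOn_symm_of_mem_maximalAtlas he)).contDiffOn

variable [IsManifold (𝓡 d) ∞ M] [RiemannianBundle (fun x : M => TangentSpace (𝓡 d) x)]
  [IsContMDiffRiemannianBundle (𝓡 d) ∞ (EuclideanSpace ℝ (Fin d))
    (fun x : M => TangentSpace (𝓡 d) x)]

/-- The differential of a smooth function on a compact Riemannian manifold is bounded. -/
lemma exists_abs_differential_le [CompactSpace M] {h : M → ℝ} (hh : ContMDiff (𝓡 d) 𝓘(ℝ, ℝ) ∞ h) :
    ∃ b : ℝ, 0 ≤ b ∧ ∀ (x : M) (w : TangentSpace (𝓡 d) x),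
      |differential h x w| ≤ b * ‖w‖ := by
  suffices H : ∃ b : ℝ, 0 ≤ b ∧ ∀ x ∈ (univ : Set M), ∀ w : TangentSpace (𝓡 d) x,
      |differential h x w| ≤ b * ‖w‖ by simpa using H
  refine isCompact_univ.induction_on (p := fun s : Set M => ∃ b : ℝ, 0 ≤ b ∧ ∀ x ∈ s,
    ∀ w : TangentSpace (𝓡 d) x, |differential h x w| ≤ b * ‖w‖)
    ⟨0, le_rfl, by simp⟩ ?_ ?_ ?_
  · rintro s t hst ⟨b, hb, h'⟩
    exact ⟨b, hb, fun x hx => h' x (hst hx)⟩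
  · rintro s t ⟨b, hb, h₁⟩ ⟨b', hb', h₂⟩
    refine ⟨max b b', hb.trans (le_max_left _ _), fun x hx w => ?_⟩
    rcases hx with hx | hx
    · exact (h₁ x hx w).trans (by gcongr; exact le_max_left _ _)
    · exact (h₂ x hx w).trans (by gcongr; exact le_max_right _ _)
  · intro x₀ _
    set e := chartAt (EuclideanSpace ℝ (Fin d)) x₀
    have he : e ∈ IsManifold.maximalAtlas (𝓡 d) ∞ M := IsManifold.chart_mem_maximalAtlas x₀
    have hx₀ : x₀ ∈ e.source := mem_chart_source _ x₀
    obtain ⟨K, hK, hKe, hKc⟩ := local_compact_nhds (e.open_target.mem_nhds (e.map_source hx₀))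
    obtain ⟨c, hc, hcK⟩ := exists_norm_le_mul_norm_chartDeriv he hKc hKe
    have hcont : ContinuousOn (fun y => ‖fderiv ℝ (h ∘ e.symm) y‖) K :=
      (((contDiffOn_comp_symm he hh).continuousOn_fderiv_of_isOpen e.open_target
        (by simp)).mono hKe).norm
    obtain ⟨b, hb⟩ := hKc.bddAbove_image hcont
    refine ⟨e.source ∩ e ⁻¹' K, mem_nhdsWithin_of_mem_nhds
      (inter_mem (e.open_source.mem_nhds hx₀) ((e.continuousAt hx₀).preimage_mem_nhds hK)),
      max b 0 * c, by positivity, ?_⟩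
    rintro x ⟨hx, hxK⟩ w
    have key : ∀ y ∈ K, ∀ w' : TangentSpace (𝓡 d) (e.symm y),
        |differential h (e.symm y) w'| ≤ max b 0 * c * ‖w'‖ := by
      intro y hy w'
      obtain ⟨v, rfl⟩ : ∃ v, chartDeriv e y v = w' :=
        (mdifferentiable_of_mem_maximalAtlas he).symm.mfderiv_surjective (hKe hy) w'
      rw [differential_apply_chartDeriv he hh (hKe hy) v, ← Real.norm_eq_abs]
      refine ((fderiv ℝ (h ∘ e.symm) y).le_opNorm v).trans ?_
      rw [mul_assoc]
      exact mul_le_mul ((hb ⟨y, hy, rfl⟩).trans (le_max_left _ _)) (hcK y hy v) (norm_nonneg _)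
        (le_max_right _ _)
    have := key (e x) hxK
    rw [e.left_inv hx] at this
    exact this w

end Differential

/-! ### Comparison of the Riemannian volume with the Lebesgue measure of a chart -/

section Volume

lemma isCompact_symm_image {d : ℕ} {M : Type*} [TopologicalSpace M]
    {e : OpenPartialHomeomorph M (EuclideanSpace ℝ (Fin d))}
    {K : Set (EuclideanSpace ℝ (Fin d))} (hK : IsCompact K) (hKe : K ⊆ e.target) :
    IsCompact (e.symm '' K) :=
  hK.image_of_continuousOn (e.continuousOn_symm.mono hKe)

variable {d : ℕ} {M : Type*} [TopologicalSpace M]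
  [ChartedSpace (EuclideanSpace ℝ (Fin d)) M]
  [IsManifold (𝓡 d) ∞ M] [RiemannianBundle (fun x : M => TangentSpace (𝓡 d) x)]
  [IsContMDiffRiemannianBundle (𝓡 d) ∞ (EuclideanSpace ℝ (Fin d))
    (fun x : M => TangentSpace (𝓡 d) x)]
  [MeasurableSpace M] [BorelSpace M]
  {e : OpenPartialHomeomorph M (EuclideanSpace ℝ (Fin d))}

/-- On a compact subset of a chart, the Lebesgue measure is controlled by the Riemannian volume.
Only the lower bound of the Riemannian volume by the measure of the chart enters. -/
lemma exists_volume_inter_le (he : e ∈ IsManifold.maximalAtlas (𝓡 d) ∞ M)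
    {K : Set (EuclideanSpace ℝ (Fin d))} (hK : IsCompact K) (hKe : K ⊆ e.target) :
    ∃ c : ℝ≥0, ∀ A : Set M, ∀ S : Set (EuclideanSpace ℝ (Fin d)), MeasurableSet S →
      MapsTo e.symm (S ∩ K) A → volume (S ∩ K) ≤ c * riemannianVolume d M A := by
  obtain ⟨a, ha, haK⟩ := exists_pos_le_volumeDensity he hK hKe
  refine ⟨(Real.toNNReal a)⁻¹, fun A S hS hA => ?_⟩
  have ha' : (Real.toNNReal a) ≠ 0 := by simpa using ha
  rw [ENNReal.coe_inv ha', ← ENNReal.div_eq_inv_mul,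
    ENNReal.le_div_iff_mul_le (Or.inl (by simpa using ha')) (Or.inl ENNReal.coe_ne_top)]
  set τ := (volume.restrict e.target).withDensity fun y => ENNReal.ofReal (volumeDensity e y)
  have hSK : MeasurableSet (S ∩ K) := hS.inter hK.isClosed.measurableSet
  have hem : AEMeasurable e.symm τ :=
    (e.continuousOn_symm.aemeasurable e.open_target.measurableSet).mono_ac
      (withDensity_absolutelyContinuous _ _)
  calc volume (S ∩ K) * (Real.toNNReal a : ℝ≥0∞)
      = ∫⁻ _ in S ∩ K, ENNReal.ofReal a := by
        rw [lintegral_const, Measure.restrict_apply MeasurableSet.univ, univ_inter, mul_comm]; rfl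
    _ ≤ ∫⁻ y in S ∩ K, ENNReal.ofReal (volumeDensity e y) :=
        setLIntegral_mono' hSK fun y hy => ENNReal.ofReal_le_ofReal (haK y hy.2)
    _ = τ (S ∩ K) := by
        rw [withDensity_apply _ hSK, Measure.restrict_restrict hSK,
          inter_eq_self_of_subset_left (inter_subset_right.trans hKe)]
    _ ≤ τ (e.symm ⁻¹' A) := measure_mono hA
    _ ≤ Measure.map e.symm τ A := Measure.le_map_apply hem A
    _ ≤ riemannianVolume d M A := by
        refine Measure.le_iff'.1 ?_ A
        exact le_iSup₂ (f := fun (e : OpenPartialHomeomorph M (EuclideanSpace ℝ (Fin d)))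
          (_ : e ∈ IsManifold.maximalAtlas (𝓡 d) ∞ M) => Measure.map e.symm
            ((volume.restrict e.target).withDensity
              fun y => ENNReal.ofReal (volumeDensity e y))) e he

variable [T2Space M]

/-- Lebesgue integrals over compact subsets of a chart, times an interval, are controlled by
integrals for the product of the Riemannian volume and `dt`. The function `f` need not be
measurable. -/
lemma exists_setLIntegral_chart_le (he : e ∈ IsManifold.maximalAtlas (𝓡 d) ∞ M)
    {K : Set (EuclideanSpace ℝ (Fin d))} (hK : IsCompact K) (hKe : K ⊆ e.target) :
    ∃ c : ℝ≥0, ∀ T : Set ℝ, MeasurableSet T → ∀ f : M × ℝ → ℝ≥0∞,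
      ∫⁻ z in K ×ˢ T, f (e.symm z.1, z.2) ≤
        c * ∫⁻ q in (e.symm '' K) ×ˢ T, f q ∂((riemannianVolume d M).prod volume) := by
  classical
  obtain ⟨c, hc⟩ := exists_volume_inter_le he hK hKe
  refine ⟨c, fun T hT f => ?_⟩
  set μ := riemannianVolume d M
  set K' := e.symm '' K
  have hK'm : MeasurableSet K' := (isCompact_symm_image hK hKe).isClosed.measurableSet
  have hK's : K' ⊆ e.source := by
    rintro _ ⟨y, hy, rfl⟩
    exact e.map_target (hKe hy)
  -- a globally measurable function that agrees with the chart on `K'`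
  set ε : M → EuclideanSpace ℝ (Fin d) := K'.piecewise e (fun _ => 0)
  have hεm : Measurable ε :=
    ContinuousOn.measurable_piecewise (e.continuousOn.mono hK's) continuousOn_const hK'm
  have hε : ∀ x ∈ K', ε x = e x := fun x hx => piecewise_eq_of_mem _ _ _ hx
  set Φ : M × ℝ → EuclideanSpace ℝ (Fin d) × ℝ := fun q => (ε q.1, q.2)
  have hΦm : Measurable Φ := (hεm.comp measurable_fst).prodMk measurable_snd
  have h₁ : (volume : Measure (EuclideanSpace ℝ (Fin d))).restrict K ≤
      (c : ℝ≥0∞) • Measure.map ε (μ.restrict K') := by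
    refine Measure.le_iff.2 fun S hS => ?_
    rw [Measure.restrict_apply hS, Measure.smul_apply, Measure.map_apply hεm hS,
      Measure.restrict_apply (hεm hS), smul_eq_mul]
    refine hc _ S hS fun y hy => ?_
    have hy' : e.symm y ∈ K' := ⟨y, hy.2, rfl⟩
    refine ⟨?_, hy'⟩
    rw [mem_preimage, hε _ hy', e.right_inv (hKe hy.2)]
    exact hy.1
  have h₂ : (volume : Measure (EuclideanSpace ℝ (Fin d) × ℝ)).restrict (K ×ˢ T) ≤
      (c : ℝ≥0∞) • Measure.map Φ ((μ.prod volume).restrict (K' ×ˢ T)) := by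
    refine Measure.le_iff.2 fun S hS => ?_
    have hτm : Measurable fun y => (volume.restrict T) (Prod.mk y ⁻¹' S) :=
      measurable_measure_prodMk_left hS
    rw [Measure.volume_eq_prod, ← Measure.prod_restrict, Measure.prod_apply hS,
      Measure.smul_apply, Measure.map_apply hΦm hS, Measure.restrict_apply (hΦm hS),
      Measure.prod_apply ((hΦm hS).inter (hK'm.prod hT)), smul_eq_mul]
    calc ∫⁻ y in K, (volume.restrict T) (Prod.mk y ⁻¹' S)
        ≤ ∫⁻ y, (volume.restrict T) (Prod.mk y ⁻¹' S)
            ∂((c : ℝ≥0∞) • Measure.map ε (μ.restrict K')) :=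
          lintegral_mono' h₁ le_rfl
      _ = c * ∫⁻ x in K', (volume.restrict T) (Prod.mk (ε x) ⁻¹' S) ∂μ := by
          rw [lintegral_smul_measure, lintegral_map hτm hεm, smul_eq_mul]
      _ = c * ∫⁻ x in K', volume (Prod.mk x ⁻¹' (Φ ⁻¹' S ∩ K' ×ˢ T)) ∂μ := by
          congr 1
          refine setLIntegral_congr_fun hK'm fun x hx => ?_
          rw [Measure.restrict_apply (measurable_prodMk_left hS)]
          congr 1
          ext t
          simp [Φ, hx]
      _ ≤ _ := by
          exact mul_le_mul_right (setLIntegral_le_lintegral _ _) _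
  calc ∫⁻ z in K ×ˢ T, f (e.symm z.1, z.2)
      ≤ ∫⁻ z, f (e.symm z.1, z.2)
          ∂((c : ℝ≥0∞) • Measure.map Φ ((μ.prod volume).restrict (K' ×ˢ T))) :=
        lintegral_mono' h₂ le_rfl
    _ ≤ c * ∫⁻ q in K' ×ˢ T, f (e.symm (Φ q).1, (Φ q).2) ∂(μ.prod volume) := by
        rw [lintegral_smul_measure, smul_eq_mul]
        gcongr
        exact lintegral_map_le _ _
    _ = _ := by
        congr 1
        refine setLIntegral_congr_fun (hK'm.prod hT) fun q hq => ?_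
        simp only [Φ]
        rw [hε _ hq.1, e.left_inv (hK's hq.1)]

variable {F : Type*} [NormedAddCommGroup F] [InnerProductSpace ℝ F]

/-- A derivative of finite energy is integrable on compact subsets of charts, up to the ends of the
collar. This holds without measurability. -/
lemma lintegral_enorm_chart_lt_top {p : ℝ} (hp : 1 ≤ p) {G : Set M}
    {DU : (q : M × ℝ) → TangentSpace (𝓡 d) q.1 × ℝ →ₗ[ℝ] F} (hDU : derivEnergy p G DU < ⊤)
    (he : e ∈ IsManifold.maximalAtlas (𝓡 d) ∞ M)
    {K : Set (EuclideanSpace ℝ (Fin d))} (hK : IsCompact K) (hKe : K ⊆ e.target ∩ e.symm ⁻¹' G)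
    (v : EuclideanSpace ℝ (Fin d) × ℝ) :
    ∫⁻ z in K ×ˢ Ioo 0 1, ‖DU (e.symm z.1, z.2) (chartDeriv e z.1 v.1, v.2)‖ₑ < ⊤ := by
  have hKt : K ⊆ e.target := hKe.trans inter_subset_left
  obtain ⟨b, hb⟩ := exists_norm_chartDeriv_le he hK hKt v.1
  obtain ⟨c, hc⟩ := exists_setLIntegral_chart_le he hK hKt
  set a : ℝ := d * max b 0 + |v.2|
  have hm : MeasurableSet (K ×ˢ Ioo (0 : ℝ) 1) := hK.isClosed.measurableSet.prod measurableSet_Ioo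
  set f : M × ℝ → ℝ≥0∞ := fun q => ENNReal.ofReal (derivNorm (DU q) ^ p)
  have hvol : volume (K ×ˢ Ioo (0 : ℝ) 1) < ⊤ :=
    (measure_mono (Set.prod_mono le_rfl Ioo_subset_Icc_self)).trans_lt
      (hK.prod isCompact_Icc).measure_lt_top
  calc ∫⁻ z in K ×ˢ Ioo 0 1, ‖DU (e.symm z.1, z.2) (chartDeriv e z.1 v.1, v.2)‖ₑ
      ≤ ∫⁻ z in K ×ˢ Ioo 0 1, ENNReal.ofReal a * (1 + f (e.symm z.1, z.2)) := by
        refine setLIntegral_mono' hm fun z hz => ?_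
        set L := DU (e.symm z.1, z.2)
        have hL := derivNorm_nonneg L
        have h1 : ‖L (chartDeriv e z.1 v.1, v.2)‖ ≤ a * (1 + derivNorm L ^ p) := by
          refine (norm_apply_le L _ _).trans ?_
          refine mul_le_mul ?_ ?_ hL (by positivity)
          · simp only [a]
            gcongr
            exact (hb _ hz.1).trans (le_max_left _ _)
          · rcases le_total (derivNorm L) 1 with h | h
            · linarith [Real.rpow_nonneg hL p]
            · linarith [Real.self_le_rpow_of_one_le h hp]
        rw [← ofReal_norm]
        refine (ENNReal.ofReal_le_ofReal h1).trans (le_of_eq ?_)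
        rw [ENNReal.ofReal_mul (by positivity), ENNReal.ofReal_add zero_le_one
          (Real.rpow_nonneg hL p), ENNReal.ofReal_one]
    _ = ENNReal.ofReal a * (volume (K ×ˢ Ioo (0 : ℝ) 1) +
          ∫⁻ z in K ×ˢ Ioo 0 1, f (e.symm z.1, z.2)) := by
        rw [lintegral_const_mul' _ _ ENNReal.ofReal_ne_top, lintegral_add_left measurable_const]
        simp
    _ ≤ ENNReal.ofReal a * (volume (K ×ˢ Ioo (0 : ℝ) 1) + c * derivEnergy p G DU) := by
        gcongr
        refine (hc _ measurableSet_Ioo f).trans ?_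
        gcongr
        refine lintegral_mono_set (Set.prod_mono ?_ le_rfl)
        rintro _ ⟨y, hy, rfl⟩
        exact (hKe hy).2
    _ < ⊤ := ENNReal.mul_lt_top ENNReal.ofReal_lt_top (ENNReal.add_lt_top.2
        ⟨hvol, ENNReal.mul_lt_top ENNReal.coe_lt_top hDU⟩)

end Volume

/-! ### Folding two extensions on the collar of a manifold -/

section Fold

/-- A smooth function on an open set agrees near each point of it with a smooth function on the
whole space. -/
lemma exists_contDiff_eqOn {E : Type*} [NormedAddCommGroup E] [InnerProductSpace ℝ E]
    {Ω : Set E} (hΩ : IsOpen Ω) {k₀ : E → ℝ} (hk₀ : ContDiffOn ℝ ∞ k₀ Ω) {y₀ : E} (hy₀ : y₀ ∈ Ω) :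
    ∃ k : E → ℝ, ContDiff ℝ ∞ k ∧ ∃ N ⊆ Ω, IsOpen N ∧ y₀ ∈ N ∧ EqOn k k₀ N := by
  obtain ⟨r, hr, hrΩ⟩ := Metric.isOpen_iff.1 hΩ y₀ hy₀
  let χ : ContDiffBump y₀ := ⟨r / 4, r / 2, by linarith, by linarith⟩
  refine ⟨fun y => χ y * k₀ y, contDiff_iff_contDiffAt.2 fun y => ?_, Metric.ball y₀ (r / 4),
    (Metric.ball_subset_ball (by linarith)).trans hrΩ, Metric.isOpen_ball,
    Metric.mem_ball_self (by linarith), fun y hy => ?_⟩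
  · by_cases hy : y ∈ Metric.ball y₀ r
    · exact χ.contDiff.contDiffAt.mul (hk₀.contDiffAt (hΩ.mem_nhds (hrΩ hy)))
    · have : (fun y => χ y * k₀ y) =ᶠ[𝓝 y] fun _ => 0 := by
        have hy' : y ∈ (Metric.closedBall y₀ (r / 2))ᶜ := fun h =>
          hy (Metric.closedBall_subset_ball (by linarith) h)
        filter_upwards [Metric.isClosed_closedBall.isOpen_compl.mem_nhds hy'] with z hz
        have hz' : r / 2 ≤ dist z y₀ := by
          by_contra! h
          exact hz (Metric.mem_closedBall.2 h.le)
        rw [χ.zero_of_le_dist hz', zero_mul]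
      exact contDiffAt_const.congr_of_eventuallyEq this
  · simp only
    rw [χ.one_of_mem_closedBall (Metric.ball_subset_closedBall hy), one_mul]

variable {d : ℕ} {M : Type*} [TopologicalSpace M]
  [ChartedSpace (EuclideanSpace ℝ (Fin d)) M] {F : Type*} [NormedAddCommGroup F]

section Deriv

variable [NormedSpace ℝ F]

/-- The derivative, in the coordinates of the chart `e`, of a map on the collar with derivative
`DU`. -/
noncomputable def derivInChart (e : OpenPartialHomeomorph M (EuclideanSpace ℝ (Fin d)))
    (DU : (q : M × ℝ) → TangentSpace (𝓡 d) q.1 × ℝ →ₗ[ℝ] F) (z : EuclideanSpace ℝ (Fin d) × ℝ) :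
    EuclideanSpace ℝ (Fin d) × ℝ →ₗ[ℝ] F :=
  DU (e.symm z.1, z.2) ∘ₗ (chartDeriv e z.1).toLinearMap.prodMap LinearMap.id

/-- The derivative of the fold of two maps with derivatives `DU₁` and `DU₂`: it follows the cases of
`fold`, with the derivatives of the shears. -/
noncomputable def foldDeriv (h : M → ℝ)
    (DU₁ DU₂ : (q : M × ℝ) → TangentSpace (𝓡 d) q.1 × ℝ →ₗ[ℝ] F) (q : M × ℝ) :
    TangentSpace (𝓡 d) q.1 × ℝ →ₗ[ℝ] F :=
  if h q.1 < q.2 then DU₁ (q.1, q.2 - h q.1) ∘ₗ shearLin 1 (-differential h q.1) else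
    if h q.1 / 2 < q.2 then DU₂ (q.1, h q.1 - q.2) ∘ₗ shearLin (-1) (differential h q.1) else DU₂ q

end Deriv

lemma hasWeakDeriv_iff {F : Type*} [NormedAddCommGroup F] [InnerProductSpace ℝ F]
    {G : Set M} {U : M × ℝ → F}
    {DU : (q : M × ℝ) → TangentSpace (𝓡 d) q.1 × ℝ →ₗ[ℝ] F} :
    HasWeakDeriv G U DU ↔ ∀ e ∈ IsManifold.maximalAtlas (𝓡 d) ∞ M,
      IsWeakDeriv ((e.target ∩ e.symm ⁻¹' G) ×ˢ Ioo 0 1) (fun z => U (e.symm z.1, z.2))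
        (derivInChart e DU) :=
  ⟨fun h e he => ⟨h.1 e he, h.2 e he, h.3 e he⟩,
    fun h => ⟨fun e he => (h e he).1, fun e he => (h e he).2, fun e he => (h e he).3⟩⟩

lemma comp_fold {X Y Z : Type*} (ι : Y → Z) (k : X → ℝ) (f₁ f₂ : X × ℝ → Y) :
    ι ∘ fold k f₁ f₂ = fold k (ι ∘ f₁) (ι ∘ f₂) := by
  ext q
  simp only [fold, Function.comp_apply]
  split_ifs <;> rfl

variable [RiemannianBundle (fun x : M => TangentSpace (𝓡 d) x)] [MeasurableSpace M]

/-- A fold of two maps with the same trace has this trace too. -/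
lemma IsTrace.fold [BorelSpace M] [T2Space M] {h : M → ℝ} (hc : Continuous h) {A B C : Set M}
    (h0 : ∀ x, 0 ≤ h x) (hA : ∀ x ∈ C, h x < 2 → x ∈ A) (hB : C ∩ tsupport h ⊆ B)
    {U₁ U₂ : M × ℝ → F} {u : M → F} (h₁ : IsTrace d A U₁ u) (h₂ : IsTrace d B U₂ u) :
    IsTrace d C (Collar.fold h U₁ U₂) u := by
  intro K hKC hK
  have hK₁ : IsCompact (K ∩ {x | h x ≤ 1}) := hK.inter_right (isClosed_le hc continuous_const)
  have hK₂ : IsCompact (K ∩ tsupport h) := hK.inter_right (isClosed_tsupport h)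
  have l₁ := h₁ _ (fun x hx => hA x (hKC hx.1) (by linarith [show h x ≤ 1 from hx.2])) hK₁
  have l₂ := h₂ _ (fun x hx => hB ⟨hKC hx.1, hx.2⟩) hK₂
  have l := l₁.add (ENNReal.Tendsto.const_mul (a := 2) l₂ (Or.inr (by simp)))
  rw [mul_zero, add_zero] at l
  refine tendsto_of_tendsto_of_tendsto_of_le_of_le' tendsto_const_nhds l
    (Eventually.of_forall fun _ => zero_le) ?_
  filter_upwards [Ioo_mem_nhdsGT (zero_lt_one' ℝ)] with ε hε
  have hsupp : ∀ x ∈ K, 0 < h x → x ∈ K ∩ tsupport h := fun x hx hx' =>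
    ⟨hx, subset_tsupport h hx'.ne'⟩
  have key := setLIntegral_fold_le (riemannianVolume d M) hc.measurable (S := K ×ˢ Ioo 0 ε)
    (T₁ := (K ∩ {x | h x ≤ 1}) ×ˢ Ioo 0 ε) (T₂ := (K ∩ tsupport h) ×ˢ Ioo 0 ε)
    (f := fun q => ‖Collar.fold h U₁ U₂ q - u q.1‖ₑ)
    (f₁ := fun q => ‖U₁ q - u q.1‖ₑ) (f₂ := fun q => ‖U₂ q - u q.1‖ₑ)
    (hK.isClosed.measurableSet.prod measurableSet_Ioo) ?_ ?_ ?_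
  · refine (mul_le_mul_right key _).trans (le_of_eq ?_)
    ring
  · rintro x t ⟨hx, ht⟩ hlt
    simp only [mem_Ioo] at hx ht
    have := h0 x
    refine ⟨⟨⟨hx, ?_⟩, by simp only; linarith, by simp only; linarith⟩, le_of_eq ?_⟩
    · simp only [mem_ofPred_eq]
      linarith [hε.2]
    · rw [Collar.fold, if_pos hlt]
  · rintro x t ⟨hx, ht⟩ hlt hlt'
    simp only [mem_Ioo] at hx ht
    refine ⟨⟨hsupp x hx (by linarith), by simp only; linarith, by simp only; linarith⟩,
      le_of_eq ?_⟩
    rw [Collar.fold, if_neg (not_lt.2 hlt'.le), if_pos hlt]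
  · rintro x t ⟨hx, ht⟩ hlt
    simp only [mem_Ioo] at hx ht
    refine ⟨⟨hsupp x hx (by linarith), ht⟩, le_of_eq ?_⟩
    rw [Collar.fold, if_neg (not_lt.2 (show t ≤ h x by linarith)), if_neg (not_lt.2 hlt)]

variable [InnerProductSpace ℝ F]

/-- The energy of a fold: the map on `A` enters once, the map on `B` twice, and the factor comes
from the shears. -/
lemma derivEnergy_foldDeriv_le {p : ℝ} (hp : 1 ≤ p) {h : M → ℝ} (hm : Measurable h) {b : ℝ}
    (hb0 : 0 ≤ b) (hb : ∀ (x : M) (w : TangentSpace (𝓡 d) x), |differential h x w| ≤ b * ‖w‖)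
    {A B C : Set M} (hC : MeasurableSet C) (h0 : ∀ x, 0 ≤ h x)
    (hA : ∀ x ∈ C, h x < 2 → x ∈ A) (hB : ∀ x ∈ C, 0 < h x → x ∈ B)
    (DU₁ DU₂ : (q : M × ℝ) → TangentSpace (𝓡 d) q.1 × ℝ →ₗ[ℝ] F) :
    derivEnergy p C (foldDeriv h DU₁ DU₂) ≤
      ENNReal.ofReal (((d + 1) * (d + b + 1)) ^ p) *
        (derivEnergy p A DU₁ + 2 * derivEnergy p B DU₂) := by
  set κ : ℝ := (d + 1) * (d + b + 1)
  have hd : (0 : ℝ) ≤ d := Nat.cast_nonneg d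
  have hκ : 1 ≤ κ := by
    have h1 : (1 : ℝ) ≤ d + 1 := by linarith
    have h2 : (1 : ℝ) ≤ d + b + 1 := by linarith
    exact one_le_mul_of_one_le_of_one_le h1 h2
  have hpow : ∀ {s r : ℝ}, 0 ≤ s → 0 ≤ r → s ≤ κ * r →
      ENNReal.ofReal (s ^ p) ≤ ENNReal.ofReal (κ ^ p) * ENNReal.ofReal (r ^ p) := by
    intro s r hs hr hsr
    rw [← ENNReal.ofReal_mul (by positivity), ← Real.mul_rpow (by positivity) hr]
    exact ENNReal.ofReal_le_ofReal (Real.rpow_le_rpow hs hsr (by linarith))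
  refine (setLIntegral_fold_le (riemannianVolume d M) hm
    (T₁ := A ×ˢ Ioo 0 1) (T₂ := B ×ˢ Ioo 0 1)
    (f₁ := fun q => ENNReal.ofReal (κ ^ p) * ENNReal.ofReal (derivNorm (DU₁ q) ^ p))
    (f₂ := fun q => ENNReal.ofReal (κ ^ p) * ENNReal.ofReal (derivNorm (DU₂ q) ^ p))
    (hC.prod measurableSet_Ioo) ?_ ?_ ?_).trans (le_of_eq ?_)
  · rintro x t ⟨hx, ht⟩ hlt
    simp only [mem_Ioo] at hx ht
    have := h0 x
    refine ⟨⟨hA x hx (by linarith), by simp only; linarith, by simp only; linarith⟩, ?_⟩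
    have e : foldDeriv h DU₁ DU₂ (x, t) = DU₁ (x, t - h x) ∘ₗ shearLin 1 (-differential h x) :=
      if_pos hlt
    rw [e]
    refine hpow (derivNorm_nonneg _) (derivNorm_nonneg _)
      (derivNorm_comp_shearLin_le (x := x) _ (by simp) _ hb0 fun w => ?_)
    rw [LinearMap.neg_apply, abs_neg]
    exact hb x w
  · rintro x t ⟨hx, ht⟩ hlt hlt'
    simp only [mem_Ioo] at hx ht
    refine ⟨⟨hB x hx (by linarith), by simp only; linarith, by simp only; linarith⟩, ?_⟩
    have e : foldDeriv h DU₁ DU₂ (x, t) = DU₂ (x, h x - t) ∘ₗ shearLin (-1) (differential h x) :=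
      (if_neg (not_lt.2 hlt'.le)).trans (if_pos hlt)
    rw [e]
    exact hpow (derivNorm_nonneg _) (derivNorm_nonneg _)
      (derivNorm_comp_shearLin_le (x := x) _ (by simp) _ hb0 (hb x))
  · rintro x t ⟨hx, ht⟩ hlt
    simp only [mem_Ioo] at hx ht
    refine ⟨⟨hB x hx (by linarith), ht⟩, ?_⟩
    have e : foldDeriv h DU₁ DU₂ (x, t) = DU₂ (x, t) :=
      (if_neg (not_lt.2 (show t ≤ h x by linarith))).trans (if_neg (not_lt.2 hlt))
    rw [e]
    exact hpow (derivNorm_nonneg _) (derivNorm_nonneg _)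
      (le_mul_of_one_le_left (derivNorm_nonneg _) hκ)
  · rw [lintegral_const_mul' _ _ ENNReal.ofReal_ne_top,
      lintegral_const_mul' _ _ ENNReal.ofReal_ne_top]
    simp only [derivEnergy]
    ring

variable [BorelSpace M] [T2Space M] [IsManifold (𝓡 d) ∞ M]
  [IsContMDiffRiemannianBundle (𝓡 d) ∞ (EuclideanSpace ℝ (Fin d))
    (fun x : M => TangentSpace (𝓡 d) x)]

/-- In a chart, two maps with the same trace approach each other in mean. -/
lemma tendsto_chart_sub {F : Type*} [NormedAddCommGroup F]
    {e : OpenPartialHomeomorph M (EuclideanSpace ℝ (Fin d))}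
    (he : e ∈ IsManifold.maximalAtlas (𝓡 d) ∞ M) {A B : Set M} {U₁ U₂ : M × ℝ → F} {u : M → F}
    (hu : StronglyMeasurable u) (h₁ : IsTrace d A U₁ u) (h₂ : IsTrace d B U₂ u)
    (hU₁ : LocallyIntegrableOn (fun z : EuclideanSpace ℝ (Fin d) × ℝ => U₁ (e.symm z.1, z.2))
      ((e.target ∩ e.symm ⁻¹' A) ×ˢ Ioo 0 1))
    {K : Set (EuclideanSpace ℝ (Fin d))} (hK : IsCompact K)
    (hKs : K ⊆ (e.target ∩ e.symm ⁻¹' A) ∩ (e.target ∩ e.symm ⁻¹' B)) :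
    Tendsto (fun δ : ℝ => (ENNReal.ofReal δ)⁻¹ *
      ∫⁻ z in K ×ˢ Ioo 0 δ, ‖U₁ (e.symm z.1, z.2) - U₂ (e.symm z.1, z.2)‖ₑ) (𝓝[>] 0) (𝓝 0) := by
  have hKt : K ⊆ e.target := fun y hy => (hKs hy).1.1
  obtain ⟨c, hc⟩ := exists_setLIntegral_chart_le he hK hKt
  have hK' : IsCompact (e.symm '' K) := isCompact_symm_image hK hKt
  have hK'A : e.symm '' K ⊆ A := by
    rintro _ ⟨y, hy, rfl⟩; exact (hKs hy).1.2
  have hK'B : e.symm '' K ⊆ B := by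
    rintro _ ⟨y, hy, rfl⟩; exact (hKs hy).2.2
  have l := (ENNReal.Tendsto.const_mul (a := c) (h₁ _ hK'A hK') (Or.inr (by simp))).add
    (ENNReal.Tendsto.const_mul (a := c) (h₂ _ hK'B hK') (Or.inr (by simp)))
  rw [mul_zero, add_zero] at l
  refine tendsto_of_tendsto_of_tendsto_of_le_of_le' tendsto_const_nhds l
    (Eventually.of_forall fun _ => zero_le) ?_
  filter_upwards [Ioo_mem_nhdsGT (zero_lt_one' ℝ)] with δ hδ
  set S := K ×ˢ Ioo (0 : ℝ) δ
  have hS : MeasurableSet S := hK.isClosed.measurableSet.prod measurableSet_Ioo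
  have m₁ : AEStronglyMeasurable (fun z : EuclideanSpace ℝ (Fin d) × ℝ => U₁ (e.symm z.1, z.2))
      (volume.restrict S) :=
    hU₁.aestronglyMeasurable.mono_measure (Measure.restrict_mono
      (Set.prod_mono (fun y hy => (hKs hy).1) (Ioo_subset_Ioo_right hδ.2.le)) le_rfl)
  have m₂ : AEMeasurable (fun z : EuclideanSpace ℝ (Fin d) × ℝ => e.symm z.1)
      (volume.restrict S) :=
    ((e.continuousOn_symm.mono hKt).comp continuousOn_fst fun z hz => hz.1).aemeasurable hS
  have m₃ : AEStronglyMeasurable (fun z : EuclideanSpace ℝ (Fin d) × ℝ => u (e.symm z.1))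
      (volume.restrict S) := hu.aestronglyMeasurable.comp_aemeasurable m₂
  have m₄ : AEMeasurable (fun z : EuclideanSpace ℝ (Fin d) × ℝ =>
      ‖U₁ (e.symm z.1, z.2) - u (e.symm z.1)‖ₑ) (volume.restrict S) := (m₁.sub m₃).enorm
  calc (ENNReal.ofReal δ)⁻¹ * ∫⁻ z in S, ‖U₁ (e.symm z.1, z.2) - U₂ (e.symm z.1, z.2)‖ₑ
      ≤ (ENNReal.ofReal δ)⁻¹ * ∫⁻ z in S, (‖U₁ (e.symm z.1, z.2) - u (e.symm z.1)‖ₑ +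
          ‖U₂ (e.symm z.1, z.2) - u (e.symm z.1)‖ₑ) := by
        gcongr with z
        rw [← sub_sub_sub_cancel_right _ _ (u (e.symm z.1))]
        exact enorm_sub_le
    _ = (ENNReal.ofReal δ)⁻¹ * ((∫⁻ z in S, ‖U₁ (e.symm z.1, z.2) - u (e.symm z.1)‖ₑ) +
          ∫⁻ z in S, ‖U₂ (e.symm z.1, z.2) - u (e.symm z.1)‖ₑ) := by
        rw [lintegral_add_left' m₄]
    _ ≤ (ENNReal.ofReal δ)⁻¹ *
          (c * ∫⁻ q in (e.symm '' K) ×ˢ Ioo 0 δ, ‖U₁ q - u q.1‖ₑ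
            ∂((riemannianVolume d M).prod volume) +
          c * ∫⁻ q in (e.symm '' K) ×ˢ Ioo 0 δ, ‖U₂ q - u q.1‖ₑ
            ∂((riemannianVolume d M).prod volume)) :=
        mul_le_mul_right (add_le_add (hc _ measurableSet_Ioo fun q => ‖U₁ q - u q.1‖ₑ)
          (hc _ measurableSet_Ioo fun q => ‖U₂ q - u q.1‖ₑ)) _
    _ = _ := by ring

/-- A fold of weakly differentiable maps of finite energy with the same trace is weakly
differentiable. -/
lemma HasWeakDeriv.fold {p : ℝ} (hp : 1 ≤ p) {h : M → ℝ} (hh : ContMDiff (𝓡 d) 𝓘(ℝ, ℝ) ∞ h)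
    {A B C : Set M} (hAo : IsOpen A) (hBo : IsOpen B) (hCo : IsOpen C) (h0 : ∀ x, 0 ≤ h x)
    (hA : ∀ x ∈ C, h x < 2 → x ∈ A) (hB : ∀ x ∈ C, 0 < h x → x ∈ B)
    {U₁ U₂ : M × ℝ → F} {DU₁ DU₂ : (q : M × ℝ) → TangentSpace (𝓡 d) q.1 × ℝ →ₗ[ℝ] F}
    (hU₁ : HasWeakDeriv A U₁ DU₁) (hU₂ : HasWeakDeriv B U₂ DU₂)
    {u : M → F} (hu : StronglyMeasurable u) (h₁ : IsTrace d A U₁ u) (h₂ : IsTrace d B U₂ u)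
    {b : ℝ} (hb₁ : ∀ q, ‖U₁ q‖ ≤ b) (hb₂ : ∀ q, ‖U₂ q‖ ≤ b)
    (hE : derivEnergy p C (foldDeriv h DU₁ DU₂) < ⊤) :
    HasWeakDeriv C (Collar.fold h U₁ U₂) (foldDeriv h DU₁ DU₂) := by
  rw [hasWeakDeriv_iff] at hU₁ hU₂ ⊢
  intro e he
  have hopen : ∀ G : Set M, IsOpen G → IsOpen (e.target ∩ e.symm ⁻¹' G) := fun G hG =>
    e.symm.isOpen_inter_preimage hG
  refine IsWeakDeriv.of_local ?_
  rintro ⟨y₀, t₀⟩ ⟨hy₀, ht₀⟩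
  obtain ⟨k, hk, N, hNΩ, hN, hyN, hkN⟩ := exists_contDiff_eqOn (hopen C hCo)
    ((contDiffOn_comp_symm he hh).mono inter_subset_left) hy₀
  have hkN' : ∀ y ∈ N, k y = h (e.symm y) := hkN
  have hdk : ∀ y ∈ N, ∀ v, fderiv ℝ k y v = differential h (e.symm y) (chartDeriv e y v) :=
    fun y hy v => by
      rw [differential_apply_chartDeriv he hh (hNΩ hy).1,
        (hkN.eventuallyEq_of_mem (hN.mem_nhds hy)).fderiv_eq]
  refine ⟨N ×ˢ Ioo 0 1, hN.prod isOpen_Ioo, ⟨hyN, ht₀⟩, ?_⟩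
  refine IsWeakDeriv.fold hN (hopen A hAo) (hopen B hBo) hk (hU₁ e he) (hU₂ e he)
    (fun y hy => ?_) (fun y hy hlt => ?_) (fun y hy hlt => ?_) (fun z hz => ?_)
    (fun y hy t hlt v => ?_) (fun y hy t hlt hlt' v => ?_) (fun y hy t hlt ht v => ?_)
    (B := b) (fun z => ?_) (fun K hKs hK v => ?_) (fun K hKs hK => ?_)
  · rw [hkN' y hy]; exact h0 _
  · rw [hkN' y hy] at hlt
    exact ⟨(hNΩ hy).1, hA _ (hNΩ hy).2 hlt⟩
  · rw [hkN' y hy] at hlt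
    exact ⟨(hNΩ hy).1, hB _ (hNΩ hy).2 hlt⟩
  · simp only [Collar.fold, hkN' _ hz.1]
  · rw [hkN' y hy] at hlt ⊢
    have e₁ : foldDeriv h DU₁ DU₂ (e.symm y, t) = DU₁ (e.symm y, t - h (e.symm y)) ∘ₗ
      shearLin 1 (-differential h (e.symm y)) := if_pos hlt
    rw [derivInChart, derivInChart, LinearMap.comp_apply, LinearMap.comp_apply]
    simp only [e₁]
    rw [LinearMap.comp_apply, shearLin_apply, hdk y hy]
    simp [sub_eq_add_neg]
  · rw [hkN' y hy] at hlt hlt' ⊢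
    have e₁ : foldDeriv h DU₁ DU₂ (e.symm y, t) = DU₂ (e.symm y, h (e.symm y) - t) ∘ₗ
      shearLin (-1) (differential h (e.symm y)) :=
      (if_neg (not_lt.2 hlt'.le)).trans (if_pos hlt)
    rw [derivInChart, derivInChart, LinearMap.comp_apply, LinearMap.comp_apply]
    simp only [e₁]
    rw [LinearMap.comp_apply, shearLin_apply, hdk y hy]
    simp [sub_eq_neg_add]
  · rw [hkN' y hy] at hlt
    have e₁ : foldDeriv h DU₁ DU₂ (e.symm y, t) = DU₂ (e.symm y, t) :=
      (if_neg (not_lt.2 (show t ≤ h (e.symm y) by linarith))).trans (if_neg (not_lt.2 hlt.le))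
    rw [derivInChart, derivInChart]
    simp only [e₁]
  · simp only [Collar.fold]
    split_ifs
    · exact hb₁ _
    · exact hb₂ _
    · exact hb₂ _
  · have hK' : Prod.fst '' K ⊆ e.target ∩ e.symm ⁻¹' C := by
      rintro _ ⟨z, hz, rfl⟩
      exact hNΩ (hKs hz).1
    exact (lintegral_mono_set (t := (Prod.fst '' K) ×ˢ Ioo 0 1)
      fun z hz => ⟨⟨z, hz, rfl⟩, (hKs hz).2⟩).trans_lt
      (lintegral_enorm_chart_lt_top hp hE he (hK.image continuous_fst) hK' v)
  · exact tendsto_chart_sub he hu h₁ h₂ (hU₁ e he).locallyIntegrableOn hK hKs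

end Fold

/-! ### Extensions with a bound on the energy -/

section Extension

variable {d : ℕ} {M : Type*} [TopologicalSpace M] [ChartedSpace (EuclideanSpace ℝ (Fin d)) M]
  [RiemannianBundle (fun x : M => TangentSpace (𝓡 d) x)] [MeasurableSpace M]

section Basic

variable {F : Type*} [NormedAddCommGroup F] [InnerProductSpace ℝ F] {N : Type*}
  {p : ℝ} {ι : N → F} {G G' : Set M} {u : M → N} {c c' : ℝ≥0∞}

variable (d) in
/-- `u|_G` is the trace of a weakly differentiable map `G × (0,1) → N` that has a weak derivative
of energy at most `c`. -/
def HasExtension (p : ℝ) (ι : N → F) (G : Set M) (u : M → N) (c : ℝ≥0∞) : Prop :=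
  ∃ (U : M × ℝ → N) (DU : (q : M × ℝ) → TangentSpace (𝓡 d) q.1 × ℝ →ₗ[ℝ] F),
    HasWeakDeriv G (ι ∘ U) DU ∧ derivEnergy p G DU ≤ c ∧ IsTrace d G (ι ∘ U) (ι ∘ u)

lemma HasExtension.mono_set (h : HasExtension d p ι G u c) (hG : G' ⊆ G) :
    HasExtension d p ι G' u c := by
  obtain ⟨U, DU, hU, hE, ht⟩ := h
  rw [hasWeakDeriv_iff] at hU
  refine ⟨U, DU, hasWeakDeriv_iff.2 fun e he => (hU e he).mono ?_, le_trans ?_ hE,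
    fun K hK => ht K (hK.trans hG)⟩
  · exact Set.prod_mono (inter_subset_inter_right _ (preimage_mono hG)) le_rfl
  · exact lintegral_mono_set (Set.prod_mono hG le_rfl)

lemma HasExtension.mono (h : HasExtension d p ι G u c) (hc : c ≤ c') :
    HasExtension d p ι G u c' := by
  obtain ⟨U, DU, hU, hE, ht⟩ := h
  exact ⟨U, DU, hU, hE.trans hc, ht⟩

lemma hasExtension_empty : HasExtension d p ι (∅ : Set M) u c := by
  refine ⟨fun q => u q.1, fun _ => 0, hasWeakDeriv_iff.2 fun e _ => ?_, ?_, fun K hK _ => ?_⟩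
  · refine IsWeakDeriv.of_local fun z hz => ?_
    simp at hz
  · simp [derivEnergy]
  · simp [subset_empty_iff.1 hK]

lemma HasExtension.memTraceSpace (h : HasExtension d p ι G u c) (hc : c < ⊤) :
    MemTraceSpace d p ι G u := by
  obtain ⟨U, DU, hU, hE, ht⟩ := h
  exact ⟨U, ⟨DU, hU, hE.trans_lt hc⟩, ht⟩

lemma MemTraceSpace.exists_hasExtension (h : MemTraceSpace d p ι G u) :
    ∃ c < ⊤, HasExtension d p ι G u c := by
  obtain ⟨U, ⟨DU, hU, hE⟩, ht⟩ := h
  exact ⟨_, hE, U, DU, hU, le_rfl, ht⟩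

lemma HasExtension.extensionEnergy_le (h : HasExtension d p ι G u c) (hc : c < ⊤) :
    extensionEnergy d p ι G u ≤ c := by
  obtain ⟨U, DU, hU, hE, ht⟩ := h
  exact iInf₂_le_of_le U ⟨⟨DU, hU, hE.trans_lt hc⟩, ht⟩ (iInf₂_le_of_le DU hU hE)

lemma hasExtension_of_extensionEnergy_lt (h : extensionEnergy d p ι G u < c) :
    HasExtension d p ι G u c := by
  simp only [extensionEnergy, energy, iInf_lt_iff] at h
  obtain ⟨U, ⟨_, ht⟩, DU, hU, hE⟩ := h
  exact ⟨U, DU, hU, hE.le, ht⟩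

end Basic

variable [T2Space M] [CompactSpace M] [IsManifold (𝓡 d) ∞ M]
  [IsContMDiffRiemannianBundle (𝓡 d) ∞ (EuclideanSpace ℝ (Fin d))
    (fun x : M => TangentSpace (𝓡 d) x)] [BorelSpace M]

/-- Extensions to the collars of `A` and `B` fold to an extension to the collar of any `C` whose
closure is covered by `A` and `B`. -/
lemma exists_hasExtension_of_closure_subset_union {p : ℝ} (hp : 1 ≤ p) {A B C : Set M}
    (hA : IsOpen A) (hB : IsOpen B) (hC : IsOpen C) (hABC : closure C ⊆ A ∪ B) :
    ∃ K : ℝ≥0, ∀ (ν : ℕ) (N : Type*) (ι : N → EuclideanSpace ℝ (Fin ν)) (u : M → N) (b : ℝ),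
      (∀ y, ‖ι y‖ ≤ b) → StronglyMeasurable (ι ∘ u) → ∀ c₁ < ⊤, ∀ c₂ < ⊤,
      HasExtension d p ι A u c₁ → HasExtension d p ι B u c₂ →
        HasExtension d p ι C u (K * (c₁ + c₂)) := by
  -- the folding function vanishes where only the extension on `A` is available, and it leaves the
  -- interval `(0, 1)` where only the extension on `B` is available
  obtain ⟨f, hf0, hf1, hf⟩ := exists_contMDiffMap_zero_one_nhds_of_isClosed (𝓡 d) (n := (⊤ : ℕ∞))
    (s := closure C \ B) (t := closure C \ A) (isClosed_closure.sdiff hB)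
    (isClosed_closure.sdiff hA) (disjoint_left.2 fun x hx hx' =>
      (hABC hx.1).elim hx'.2 hx.2)
  set h : M → ℝ := fun x => 2 * f x
  have hh : ContMDiff (𝓡 d) 𝓘(ℝ, ℝ) ∞ h := contMDiff_const.mul f.contMDiff
  have h0 : ∀ x, 0 ≤ h x := fun x => mul_nonneg zero_le_two (hf x).1
  have hhA : ∀ x ∈ C, h x < 2 → x ∈ A := fun x hx hlt => by
    by_contra hxA
    have : f x = 1 := hf1.self_of_nhdsSet x ⟨subset_closure hx, hxA⟩
    simp only [h, this] at hlt
    linarith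
  have hhB : C ∩ tsupport h ⊆ B := fun x hx => by
    by_contra hxB
    have hx0 : ∀ᶠ y in 𝓝 x, f y = 0 :=
      hf0.filter_mono
        (nhds_le_nhdsSet (show x ∈ closure C \ B from ⟨subset_closure hx.1, hxB⟩))
    refine notMem_tsupport_iff_eventuallyEq.2 ?_ hx.2
    filter_upwards [hx0] with y hy
    simp [h, hy]
  have hhB' : ∀ x ∈ C, 0 < h x → x ∈ B := fun x hx hlt =>
    hhB ⟨hx, subset_tsupport h hlt.ne'⟩
  obtain ⟨b', hb'0, hb'⟩ := exists_abs_differential_le hh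
  refine ⟨2 * (((d + 1) * (d + b' + 1)) ^ p).toNNReal, fun ν N ι u b hb hu c₁ hc₁ c₂ hc₂ => ?_⟩
  rintro ⟨U₁, DU₁, hU₁, hE₁, ht₁⟩ ⟨U₂, DU₂, hU₂, hE₂, ht₂⟩
  have hE : derivEnergy p C (foldDeriv h DU₁ DU₂) ≤
      ((2 * (((d + 1) * (d + b' + 1)) ^ p).toNNReal : ℝ≥0) : ℝ≥0∞) * (c₁ + c₂) := by
    refine (derivEnergy_foldDeriv_le hp hh.continuous.measurable hb'0 hb' hC.measurableSet h0
      hhA hhB' DU₁ DU₂).trans ?_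
    rw [mul_comm (2 : ℝ≥0), ENNReal.coe_mul, ENNReal.coe_ofNat, mul_assoc]
    refine mul_le_mul_right ?_ _
    rw [mul_add]
    refine add_le_add (hE₁.trans (le_mul_of_one_le_left' one_le_two)) (mul_le_mul_right hE₂ _)
  refine ⟨fold h U₁ U₂, foldDeriv h DU₁ DU₂, ?_, hE, ?_⟩
  · rw [comp_fold]
    exact HasWeakDeriv.fold hp hh hA hB hC h0 hhA hhB' hU₁ hU₂ hu ht₁ ht₂ (fun q => hb _)
      (fun q => hb _) (hE.trans_lt (ENNReal.mul_lt_top ENNReal.coe_lt_top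
        (ENNReal.add_lt_top.2 ⟨hc₁, hc₂⟩)))
  · rw [comp_fold]
    exact IsTrace.fold hh.continuous h0 hhA hhB ht₁ ht₂

/-- Extensions to the collars of finitely many open sets combine to an extension to the collar of
any open `C` whose closure they cover: they are folded together one after the other. -/
lemma exists_hasExtension_of_closure_subset_iUnion {p : ℝ} (hp : 1 ≤ p) {I : Type*} {G : I → Set M}
    (hG : ∀ i, IsOpen (G i)) (s : Finset I) :
    ∀ C : Set M, IsOpen C → closure C ⊆ ⋃ i ∈ s, G i →
    ∃ K : ℝ≥0, ∀ (ν : ℕ) (N : Type*) (ι : N → EuclideanSpace ℝ (Fin ν)) (u : M → N) (b : ℝ),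
      (∀ y, ‖ι y‖ ≤ b) → StronglyMeasurable (ι ∘ u) → ∀ c : I → ℝ≥0∞, (∀ i, c i < ⊤) →
      (∀ i, HasExtension d p ι (G i) u (c i)) →
        HasExtension d p ι C u (K * ∑ i ∈ s, c i) := by
  classical
  induction s using Finset.induction_on with
  | empty =>
    intro C _ hCs
    have : C = ∅ := subset_empty_iff.1 (subset_closure.trans (by simpa using hCs))
    subst this
    exact ⟨0, fun ν N ι u b _ _ c _ _ => hasExtension_empty⟩
  | insert a s ha ih =>
    intro C hC hCs
    rw [Finset.set_biUnion_insert] at hCs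
    obtain ⟨D, hD, hCD, hDs⟩ := normal_exists_closure_subset
      (isClosed_closure.sdiff (hG a) : IsClosed (closure C \ G a))
      (isOpen_biUnion fun i (_ : i ∈ s) => hG i)
      (fun x hx => (hCs hx.1).resolve_left hx.2)
    obtain ⟨K₁, hK₁⟩ := ih D hD hDs
    obtain ⟨K₂, hK₂⟩ := exists_hasExtension_of_closure_subset_union (d := d) hp hD (hG a) hC
      (fun x hx => (em (x ∈ G a)).elim Or.inr fun h => Or.inl (hCD ⟨hx, h⟩))
    refine ⟨K₂ * (K₁ + 1), fun ν N ι u b hb hu c hc hext => ?_⟩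
    refine (hK₂ ν N ι u b hb hu _ (ENNReal.mul_lt_top ENNReal.coe_lt_top
      (ENNReal.sum_lt_top.2 fun i _ => hc i)) _ (hc a) (hK₁ ν N ι u b hb hu c hc hext)
      (hext a)).mono ?_
    rw [Finset.sum_insert ha, ENNReal.coe_mul, mul_assoc, ENNReal.coe_add, ENNReal.coe_one]
    refine mul_le_mul_right ?_ _
    rw [add_comm (c a), mul_add]
    refine add_le_add (mul_le_mul_left le_self_add _) (le_mul_of_one_le_left' le_add_self)

end Extension

end Collar

theorem theorem1p1 {d : ℕ} {M : Type*} [TopologicalSpace M] [T2Space M] [CompactSpace M]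
    [ChartedSpace (EuclideanSpace ℝ (Fin d)) M] [IsManifold (𝓡 d) ∞ M]
    [RiemannianBundle (fun x : M => TangentSpace (𝓡 d) x)]
    [IsContMDiffRiemannianBundle (𝓡 d) ∞ (EuclideanSpace ℝ (Fin d))
      (fun x : M => TangentSpace (𝓡 d) x)]
    [MeasurableSpace M] [BorelSpace M]
    {I : Type*} [Fintype I] (G : I → Set M) (hG : ∀ i, IsOpen (G i)) (hcover : ⋃ i, G i = univ)
    (p : ℝ) (hp : 1 ≤ p) :
    ∃ C : ℝ≥0, ∀ (n ν : ℕ) (N : Type*) [TopologicalSpace N] [T2Space N] [CompactSpace N]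
      [ChartedSpace (EuclideanSpace ℝ (Fin n)) N] [IsManifold (𝓡 n) ∞ N]
      [RiemannianBundle (fun y : N => TangentSpace (𝓡 n) y)]
      [IsContMDiffRiemannianBundle (𝓡 n) ∞ (EuclideanSpace ℝ (Fin n))
        (fun y : N => TangentSpace (𝓡 n) y)]
      [MeasurableSpace N] [BorelSpace N]
      (ι : N → EuclideanSpace ℝ (Fin ν)) (_ : Collar.IsIsometricEmbedding (n := n) ι)
      (u : M → N) (_ : Measurable u),
      (Collar.MemTraceSpace d p ι univ u ↔ ∀ i, Collar.MemTraceSpace d p ι (G i) u) ∧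
      Collar.extensionEnergy d p ι univ u ≤ C * ∑ i, Collar.extensionEnergy d p ι (G i) u := by
  obtain ⟨K, hK⟩ := Collar.exists_hasExtension_of_closure_subset_iUnion (d := d) hp hG Finset.univ
    univ isOpen_univ (by simp [hcover])
  -- the constant is kept positive, so that `0 * ∞` does not occur in the estimate
  refine ⟨K + 1, ?_⟩
  intro n ν N _ _ _ _ _ _ _ _ _ ι hι u hu
  have hιc : Continuous ι := hι.isEmbedding.continuous
  obtain ⟨b, hb⟩ := (isCompact_range hιc).isBounded.exists_norm_le
  have hext := hK ν N ι u b (fun y => hb _ ⟨y, rfl⟩) (hιc.measurable.comp hu).stronglyMeasurable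
  refine ⟨⟨fun h i => ?_, fun h => ?_⟩, ?_⟩
  · obtain ⟨c, hc, hU⟩ := h.exists_hasExtension
    exact (hU.mono_set (subset_univ _)).memTraceSpace hc
  · choose c hc hU using fun i => (h i).exists_hasExtension
    exact (hext c hc hU).memTraceSpace (ENNReal.mul_lt_top ENNReal.coe_lt_top
      (ENNReal.sum_lt_top.2 fun i _ => hc i))
  · set E : I → ℝ≥0∞ := fun i => Collar.extensionEnergy d p ι (G i) u
    by_cases hE : ∀ i, E i < ⊤
    · -- near-optimal extensions on the sets `G i`, with an excess `δ` that tends to `0`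
      have hle : Collar.extensionEnergy d p ι univ u ≤ K * ∑ i, E i := by
        have hcont : Continuous fun δ : ℝ≥0∞ => K * ∑ i, (E i + δ) :=
          (ENNReal.continuous_const_mul ENNReal.coe_ne_top).comp
            (continuous_finsetSum _ fun i _ => continuous_const.add continuous_id)
        have hlim : Tendsto (fun δ : ℝ≥0∞ => K * ∑ i, (E i + δ)) (𝓝[>] 0) (𝓝 (K * ∑ i, E i)) := by
          simpa using (hcont.tendsto 0).mono_left nhdsWithin_le_nhds
        refine ge_of_tendsto hlim ?_
        filter_upwards [Ioo_mem_nhdsGT (zero_lt_one' ℝ≥0∞)] with δ hδ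
        have hfin : ∀ i, E i + δ < ⊤ := fun i =>
          ENNReal.add_lt_top.2 ⟨hE i, hδ.2.trans ENNReal.one_lt_top⟩
        exact (hext (fun i => E i + δ) hfin fun i => Collar.hasExtension_of_extensionEnergy_lt
          (ENNReal.lt_add_right (hE i).ne hδ.1.ne')).extensionEnergy_le
            (ENNReal.mul_lt_top ENNReal.coe_lt_top (ENNReal.sum_lt_top.2 fun i _ => hfin i))
      exact hle.trans (mul_le_mul_left (by simp) _)
    · push Not at hE
      obtain ⟨i, hi⟩ := hE
      have : ∑ i, E i = ⊤ := ENNReal.sum_eq_top.2 ⟨i, Finset.mem_univ i, top_le_iff.1 hi⟩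
      rw [this, ENNReal.mul_top (by simp)]
      exact le_top
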